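/- **Setting.** Let $(\Omega_1,\mathcal A_1)$, $(\Omega_2,\mathcal A_2)$ be measurable spaces, $\mathcal P$ and $\mathcal Q$ nonempty families of probability measures on them, and $\mathcal P\otimes\mathcal Q=\{P\otimes Q: P\in\mathcal P,\ Q\in\mathcal Q\}$. For probability measures $P,Q$ on the same space with densities $f_P,f_Q$ with respect to $P+Q$, let the density quotient be $\frac{dP}{dQ}=\frac{f_P}{f_Q}\mathbf 1_{\{f_Q>0\}}+\infty\,\mathbf 1_{\{f_Q=0,\ f_P>0\}}$. A curve $t\mapsto R_t$, defined for $|t|<\varepsilon$ with values in a family $\mathcal R$ of probability measures, is *$L_2(0)$-differentiable in $\mathcal R$ with tangent* $g\in L_2(R_0)$ if, as $t\to0$, $$\Big\|2\Big(\big(\tfrac{dR_t}{dR_0}\big)^{1/2}-1\Big)-tg\Big\|_{L_2(R_0)}=o(|t|)\quad\text{and}\quad R_t\Big(\big\{\tfrac{dR_t}{dR_0}=\infty\big\}\Big)=o(t^2).$$ Such a tangent satisfies $\int g\,dR_0=0$. The tangent space $T(R,\mathcal R)$ is the $L_2(R)$-closure of the linear span of the tangents of all such curves with $R_0=R$. A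 *gradient* at $R\in\mathcal R$ of a functional $k:\mathcal R\to\mathbb R$ is a function $\dot k\in L_2(R)$ with $\int\dot k\,dR=0$ such that $\lim_{t\downarrow0}\frac1t(k(R_t)-k(R))=\int\dot k g\,dR$ for every $L_2(0)$-differentiable curve in $\mathcal R$ with $R_0=R$ and tangent $g$; $k$ is *differentiable* at $R$ if a gradient exists, and the *canonical gradient* $\widetilde k$ is then the gradient in $T(R,\mathcal R)$ of smallest $L_2(R)$-norm. Let $k:\mathcal P\otimes\mathcal Q\to\mathbb R$ be differentiable at $P_0\otimes Q_0\in\mathcal P\otimes\mathcal Q$ with canonical gradient $\widetilde k$, and put $\widetilde k_1(\omega_1)=\int\widetilde k(\omega_1,\omega_2)\,dQ_0(\omega_2)$, $\widetilde k_2(\omega_2)=\int\widetilde k(\omega_1,\omega_2)\,dP_0(\omega_1)$. Let $\alpha\in(0,1)$, and let $n_1=n_1(n)$, $n_2=n_2(n)$ be sample sizes with $n_1+n_2=n$ for all $n$ and $\lim_{n\to\infty} n_2/n=d\in(0,1)$. On $\Omega_1^{n_1}\times\Omega_2^{n_2}$ let $$T_n=\frac{\sqrt n}{n_1n_2}\sum_{i=1}^{n_1}\sum_{j=1}^{n_2}\widetilde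 k(\omega_{1,i},\omega_{2,j}),\qquad c=u_{1-\alpha}\Big(\tfrac1{1-d}\int\widetilde k_1^2\,dP_0+\tfrac1d\int\widetilde k_2^2\,dQ_0\Big)^{1/2},$$ where $u_{1-\alpha}$ is the $(1-\alpha)$-quantile of the standard normal distribution, and let $\psi_n=1$ if $T_n>c$ and $\psi_n=0$ if $T_n\le c$. **Theorem.** Assume $\int\widetilde k^2\,d(P_0\otimes Q_0)\neq0$. Let $t\mapsto P_t\otimes Q_t$ and $s\mapsto\widetilde P_s\otimes\widetilde Q_s$ be two $L_2(0)$-differentiable curves in $\mathcal P\otimes\mathcal Q$, with tangents $g$ and $h$, both passing through $P_0\otimes Q_0=\widetilde P_0\otimes\widetilde Q_0$ at parameter $0$. Suppose that $$\lim_{n\to\infty}\frac{k(P_{t_n}\otimes Q_{t_n})-k(P_0\otimes Q_0)}{n^{-1/2}}>0\quad\text{and}\quad\lim_{n\to\infty}\frac{k(\widetilde P_{s_n}\otimes\widetilde Q_{s_n})-k(\widetilde P_0\otimes\widetilde Q_0)}{n^{-1/2}}\le0$$ for all null sequences $(t_n)$ with $\lim_{n\to\infty} t_n\sqrt n>0$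 and all null sequences $(s_n)$ with $\lim_{n\to\infty} s_n\sqrt n>0$ (all these limits being assumed to exist in $\mathbb R$). Then the sequence of tests $(\psi_n)$ is asymptotically unbiased of level $\alpha$ for testing $$H_n^{p,e}=\{\widetilde P_{s_n}^{n_1}\otimes\widetilde Q_{s_n}^{n_2}\}\quad\text{against}\quad K_n^p=\{P_{t_n}^{n_1}\otimes Q_{t_n}^{n_2}\},$$ that is, for all such null sequences $(s_n)$ and $(t_n)$, $$\limsup_{n\to\infty}\int\psi_n\,d\big(\widetilde P_{s_n}^{n_1}\otimes\widetilde Q_{s_n}^{n_2}\big)\le\alpha\quad\text{and}\quad\liminf_{n\to\infty}\int\psi_n\,d\big(P_{t_n}^{n_1}\otimes Q_{t_n}^{n_2}\big)\ge\alpha.$$ -/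

import Mathlib

open MeasureTheory ProbabilityTheory Filter Topology Asymptotics
open scoped ENNReal

noncomputable section

section Differentiability

variable {Ω : Type*} [MeasurableSpace Ω]

/-- The density quotient `dP/dQ` of two probability measures, with values in `[0, ∞]`: with the
densities `f_P`, `f_Q` with respect to `P + Q` it is `f_P / f_Q` where `f_Q > 0`, it is `∞` where
`f_Q = 0 < f_P` and it is `0` where both vanish (these are the conventions of division
in `ℝ≥0∞`). -/
def densityQuotient (P Q : ProbabilityMeasure Ω) (ω : Ω) : ℝ≥0∞ :=
  (P : Measure Ω).rnDeriv ((P : Measure Ω) + (Q : Measure Ω)) ω /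
    (Q : Measure Ω).rnDeriv ((P : Measure Ω) + (Q : Measure Ω)) ω

/-- `t ↦ γ t` is an `L₂(γ 0)`-differentiable curve in the family `F` with tangent `g`.
The curve lives on some interval `(-ε, ε)`; the values of `γ` outside are irrelevant. -/
structure IsL2DiffCurve (F : Set (ProbabilityMeasure Ω)) (γ : ℝ → ProbabilityMeasure Ω)
    (g : Ω → ℝ) : Prop where
  mem_family : ∃ ε : ℝ, 0 < ε ∧ ∀ t : ℝ, |t| < ε → γ t ∈ F
  memLp : MemLp g 2 (γ 0 : Measure Ω)
  norm_isLittleO :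
    (fun t : ℝ => (eLpNorm
        (fun ω => 2 * (Real.sqrt (densityQuotient (γ t) (γ 0) ω).toReal - 1) - t * g ω)
        2 (γ 0 : Measure Ω)).toReal) =o[𝓝[≠] 0] fun t : ℝ => |t|
  singular_isLittleO :
    (fun t : ℝ => (γ t : Measure Ω).real {ω | densityQuotient (γ t) (γ 0) ω = ∞})
      =o[𝓝[≠] 0] fun t : ℝ => t ^ 2

/-- The tangent cone `K(P, F)`, as a subset of `L₂(P)`. -/
def familyTangentCone (F : Set (ProbabilityMeasure Ω)) (P : ProbabilityMeasure Ω) :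
    Set (Lp ℝ 2 (P : Measure Ω)) :=
  {g | ∫ ω, g ω ∂(P : Measure Ω) = 0 ∧
    ∃ γ : ℝ → ProbabilityMeasure Ω, γ 0 = P ∧ IsL2DiffCurve F γ g}

/-- The tangent space `T(P, F)`: the `L₂(P)`-closure of the linear span of the tangent cone. -/
def familyTangentSpace (F : Set (ProbabilityMeasure Ω)) (P : ProbabilityMeasure Ω) :
    Submodule ℝ (Lp ℝ 2 (P : Measure Ω)) :=
  (Submodule.span ℝ (familyTangentCone F P)).topologicalClosure

/-- `kdot ∈ L₂⁽⁰⁾(P)` is a gradient at `P` of the statistical functional `k` on `F`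
(only the values of `k` on `F` matter). -/
structure IsGradient (F : Set (ProbabilityMeasure Ω)) (k : ProbabilityMeasure Ω → ℝ)
    (P : ProbabilityMeasure Ω) (kdot : Ω → ℝ) : Prop where
  measurable : Measurable kdot
  memLp : MemLp kdot 2 (P : Measure Ω)
  integral_eq_zero : ∫ ω, kdot ω ∂(P : Measure Ω) = 0
  tendsto : ∀ (γ : ℝ → ProbabilityMeasure Ω) (g : Ω → ℝ), γ 0 = P → IsL2DiffCurve F γ g →
    Tendsto (fun t : ℝ => t⁻¹ * (k (γ t) - k P)) (𝓝[>] 0)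
      (𝓝 (∫ ω, kdot ω * g ω ∂(P : Measure Ω)))

/-- `ktil` is (a version of) the canonical gradient at `P` of the functional `k` on `F`: the
gradient that lies in the tangent space and has the smallest norm among all gradients. -/
structure IsCanonicalGradient (F : Set (ProbabilityMeasure Ω)) (k : ProbabilityMeasure Ω → ℝ)
    (P : ProbabilityMeasure Ω) (ktil : Ω → ℝ) : Prop where
  isGradient : IsGradient F k P ktil
  mem_tangentSpace : isGradient.memLp.toLp ktil ∈ familyTangentSpace F P
  norm_le : ∀ kdot : Ω → ℝ, IsGradient F k P kdot →
    eLpNorm ktil 2 (P : Measure Ω) ≤ eLpNorm kdot 2 (P : Measure Ω)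

end Differentiability

/-- The quantile function of the standard normal distribution. -/
def stdNormalQuantile (p : ℝ) : ℝ := sInf {x : ℝ | p ≤ cdf (gaussianReal 0 1) x}

/-- A null sequence `s` for which `lim s_n √n` exists and is positive. -/
def IsLocalSeq (s : ℕ → ℝ) : Prop :=
  Tendsto s atTop (𝓝 0) ∧
    ∃ τ : ℝ, 0 < τ ∧ Tendsto (fun n : ℕ => s n * Real.sqrt n) atTop (𝓝 τ)

/-- The sequence `φ` of tests is asymptotically unbiased of level `α` for the hypotheses `H`
against the alternatives `K`, both being sets of sequences of measures. -/
structure IsAsymptoticallyUnbiased {X : ℕ → Type*} [∀ n, MeasurableSpace (X n)] (α : ℝ)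
    (φ : ∀ n, X n → ℝ) (H K : Set (∀ n, Measure (X n))) : Prop where
  measurable : ∀ n, Measurable (φ n)
  mem_Icc : ∀ n x, φ n x ∈ Set.Icc (0 : ℝ) 1
  limsup_le : ∀ μ ∈ H, limsup (fun n => ∫ x, φ n x ∂(μ n)) atTop ≤ α
  le_liminf : ∀ μ ∈ K, α ≤ liminf (fun n => ∫ x, φ n x ∂(μ n)) atTop

section TwoSample

variable {Ω₁ Ω₂ : Type*} [MeasurableSpace Ω₁] [MeasurableSpace Ω₂]

/-- The family `Pfam ⊗ Qfam` of product measures. -/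
def prodFamily (Pfam : Set (ProbabilityMeasure Ω₁)) (Qfam : Set (ProbabilityMeasure Ω₂)) :
    Set (ProbabilityMeasure (Ω₁ × Ω₂)) :=
  {μ | ∃ P ∈ Pfam, ∃ Q ∈ Qfam, μ = P.prod Q}

/-- The law `P^{n₁} ⊗ Q^{n₂}` of two independent samples of sizes `n₁` and `n₂`. -/
def sampleLaw (P : ProbabilityMeasure Ω₁) (Q : ProbabilityMeasure Ω₂) (n₁ n₂ : ℕ) :
    Measure ((Fin n₁ → Ω₁) × (Fin n₂ → Ω₂)) :=
  (Measure.pi fun _ : Fin n₁ => (P : Measure Ω₁)).prod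
    (Measure.pi fun _ : Fin n₂ => (Q : Measure Ω₂))

/-- The two-sample U-statistic with kernel `f`. -/
def twoSampleUStat (f : Ω₁ × Ω₂ → ℝ) (n₁ n₂ : ℕ)
    (x : (Fin n₁ → Ω₁) × (Fin n₂ → Ω₂)) : ℝ :=
  1 / ((n₁ : ℝ) * n₂) * ∑ i : Fin n₁, ∑ j : Fin n₂, f (x.1 i, x.2 j)

/-- The test statistic `T_n = √n U_{n₁,n₂}`, where `n = n₁ + n₂`. -/
def twoSampleTestStat (f : Ω₁ × Ω₂ → ℝ) (n₁ n₂ : ℕ)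
    (x : (Fin n₁ → Ω₁) × (Fin n₂ → Ω₂)) : ℝ :=
  Real.sqrt ((n₁ + n₂ : ℕ) : ℝ) * twoSampleUStat f n₁ n₂ x

/-- The first component `ω₁ ↦ ∫ f(ω₁, ω₂) dQ(ω₂)` of `f`. -/
def firstComponent (Q : ProbabilityMeasure Ω₂) (f : Ω₁ × Ω₂ → ℝ) (ω₁ : Ω₁) : ℝ :=
  ∫ ω₂, f (ω₁, ω₂) ∂(Q : Measure Ω₂)

/-- The second component `ω₂ ↦ ∫ f(ω₁, ω₂) dP(ω₁)` of `f`. -/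
def secondComponent (P : ProbabilityMeasure Ω₁) (f : Ω₁ × Ω₂ → ℝ) (ω₂ : Ω₂) : ℝ :=
  ∫ ω₁, f (ω₁, ω₂) ∂(P : Measure Ω₁)

/-- The critical value
`c = u_{1-α} (1/(1-d) ∫ f₁² dP + 1/d ∫ f₂² dQ)^{1/2}`. -/
def criticalValue (P : ProbabilityMeasure Ω₁) (Q : ProbabilityMeasure Ω₂) (f : Ω₁ × Ω₂ → ℝ)
    (d α : ℝ) : ℝ :=
  stdNormalQuantile (1 - α) *
    Real.sqrt (1 / (1 - d) * ∫ ω₁, firstComponent Q f ω₁ ^ 2 ∂(P : Measure Ω₁) +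
      1 / d * ∫ ω₂, secondComponent P f ω₂ ^ 2 ∂(Q : Measure Ω₂))

open Classical in
/-- The one-sided test: it rejects (value `1`) if `T_n > c` and accepts (value `0`)
if `T_n ≤ c`. -/
def oneSidedTest (P : ProbabilityMeasure Ω₁) (Q : ProbabilityMeasure Ω₂) (f : Ω₁ × Ω₂ → ℝ)
    (d α : ℝ) (n₁ n₂ : ℕ) (x : (Fin n₁ → Ω₁) × (Fin n₂ → Ω₂)) : ℝ :=
  if criticalValue P Q f d α < twoSampleTestStat f n₁ n₂ x then 1 else 0

/-- The sequences `(P_{s_n}^{n₁} ⊗ Q_{s_n}^{n₂})_n` along the curve `s ↦ P_s ⊗ Q_s`, for all null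
sequences `(s_n)` with `lim s_n √n > 0`. -/
def localSequences (P : ℝ → ProbabilityMeasure Ω₁) (Q : ℝ → ProbabilityMeasure Ω₂)
    (n₁ n₂ : ℕ → ℕ) : Set (∀ n, Measure ((Fin (n₁ n) → Ω₁) × (Fin (n₂ n) → Ω₂))) :=
  {μ | ∃ s : ℕ → ℝ, IsLocalSeq s ∧ μ = fun n => sampleLaw (P (s n)) (Q (s n)) (n₁ n) (n₂ n)}

/-- The rescaled local value `(k(P_s ⊗ Q_s) - k(P_0 ⊗ Q_0)) / n^{-1/2}` of the functional. -/
def localValue (k : ProbabilityMeasure (Ω₁ × Ω₂) → ℝ) (P : ℝ → ProbabilityMeasure Ω₁)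
    (Q : ℝ → ProbabilityMeasure Ω₂) (n : ℕ) (s : ℝ) : ℝ :=
  (k ((P s).prod (Q s)) - k ((P 0).prod (Q 0))) / (n : ℝ) ^ (-(1 / 2) : ℝ)

end TwoSample

end

/-! Under local alternatives `T_n` is asymptotically normal, and its limiting mean is the limit of
the rescaled increment of `k`. The sign of that increment therefore decides on which side of `α` the
limiting rejection probability lies.

Tangents of product curves carry no interaction. If `a`, `b` are the root densities of the two
factors, then `ab - 1 = (a - 1) + (b - 1) + (a - 1)(b - 1)`, and the last term has `L₂`-norm
`O(t²)`. So a tangent is orthogonal to every function with vanishing partial integrals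
(`HasScore.integral_mul_eq_zero`). This passes to the closed span, hence the canonical gradient is
almost everywhere the sum of its two components (`ae_eq_components_of_mem_tangentSpace`), and `T_n`
becomes a sum of two independent i.i.d. sums.

The additive form holds only up to a `P₀ ⊗ Q₀`-null set, which the laws on the curve may charge.
Their singular parts have mass `o(t²)`, while there are only `O(n)` observations and `n t_n²` is
bounded, so this event is negligible (`measureReal_sampleLaw_exists_mem_le`).

The marginal curves inherit the components of the tangent as scores (`HasScore.fst`,
`HasScore.snd`). Characteristic functions are expanded directly under the local law
(`HasScore.tendsto_pow_integral_cexp`), without a likelihood expansion or contiguity. The limit is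
normal with mean `τ ∫ k̃ g` and the variance that appears in the critical value
(`tendsto_map_testStat`). By definition of a gradient, the same number `τ ∫ k̃ g` is the limit of
`localValue` (`tendsto_localValue`). -/

open MeasureTheory ProbabilityTheory Filter Topology Asymptotics
open scoped ENNReal

noncomputable section

/-! ### Root densities, singular parts and their behaviour under products. -/

section RootDensity

variable {Ω Ω' : Type*} [MeasurableSpace Ω] [MeasurableSpace Ω']

/-- The square root of the density of the absolutely continuous part of `P` with respect to `Q`. -/
def rootDensity (P Q : Measure Ω) (ω : Ω) : ℝ := √(P.rnDeriv Q ω).toReal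

lemma measurable_rootDensity (P Q : Measure Ω) : Measurable (rootDensity P Q) :=
  (P.measurable_rnDeriv Q).ennreal_toReal.sqrt

lemma rootDensity_nonneg (P Q : Measure Ω) (ω : Ω) : 0 ≤ rootDensity P Q ω := Real.sqrt_nonneg _

lemma rootDensity_sq (P Q : Measure Ω) (ω : Ω) :
    rootDensity P Q ω ^ 2 = (P.rnDeriv Q ω).toReal := Real.sq_sqrt ENNReal.toReal_nonneg

lemma integrable_rootDensity_sq (P Q : Measure Ω) [IsFiniteMeasure P] :
    Integrable (fun ω => rootDensity P Q ω ^ 2) Q := by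
  simp_rw [rootDensity_sq]
  exact Measure.integrable_toReal_rnDeriv

lemma memLp_rootDensity (P Q : Measure Ω) [IsFiniteMeasure P] :
    MemLp (rootDensity P Q) 2 Q :=
  (memLp_two_iff_integrable_sq (measurable_rootDensity P Q).aestronglyMeasurable).2
    (integrable_rootDensity_sq P Q)

lemma integral_rootDensity_sq (P Q : Measure Ω) [IsProbabilityMeasure P] [IsProbabilityMeasure Q] :
    ∫ ω, rootDensity P Q ω ^ 2 ∂Q = 1 - (P.singularPart Q).real Set.univ := by
  simp_rw [rootDensity_sq]
  rw [Measure.integral_toReal_rnDeriv']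
  simp

lemma integral_rootDensity_sq_le (P Q : Measure Ω) [IsProbabilityMeasure P]
    [IsProbabilityMeasure Q] : ∫ ω, rootDensity P Q ω ^ 2 ∂Q ≤ 1 := by
  rw [integral_rootDensity_sq]
  linarith [measureReal_nonneg (μ := P.singularPart Q) (s := Set.univ)]

/-- The difference is the integral of `f` against the singular part, whose mass is the right-hand
side. -/
lemma norm_integral_sub_integral_rootDensity_sq_le (P Q : Measure Ω) [IsProbabilityMeasure P]
    [IsProbabilityMeasure Q] {f : Ω → ℂ} (hf : Measurable f) (hf1 : ∀ ω, ‖f ω‖ ≤ 1) :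
    ‖∫ ω, f ω ∂P - ∫ ω, (rootDensity P Q ω ^ 2 : ℝ) * f ω ∂Q‖ ≤
      1 - ∫ ω, rootDensity P Q ω ^ 2 ∂Q := by
  have hint : ∀ μ : Measure Ω, IsFiniteMeasure μ → Integrable f μ := fun μ _ =>
    Integrable.of_bound hf.aestronglyMeasurable 1 (ae_of_all _ hf1)
  have h1 : ∫ ω, f ω ∂P = ∫ ω, f ω ∂(P.singularPart Q) +
      ∫ ω, f ω ∂(Q.withDensity (P.rnDeriv Q)) := by
    conv_lhs => rw [← P.singularPart_add_rnDeriv Q]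
    exact integral_add_measure (hint _ inferInstance) (hint _ inferInstance)
  have h2 : ∫ ω, f ω ∂(Q.withDensity (P.rnDeriv Q)) =
      ∫ ω, (rootDensity P Q ω ^ 2 : ℝ) * f ω ∂Q := by
    rw [integral_withDensity_eq_integral_toReal_smul (P.measurable_rnDeriv Q)
      (P.rnDeriv_lt_top Q)]
    simp_rw [rootDensity_sq]
    rfl
  rw [h1, h2, add_sub_cancel_right, integral_rootDensity_sq, sub_sub_cancel]
  simpa using norm_integral_le_of_norm_le_const (μ := P.singularPart Q) (ae_of_all _ hf1)

/-- Splitting both factors into singular and absolutely continuous parts, every product containing a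
singular factor is singular to `P₀ ⊗ Q₀`. Uniqueness of the Lebesgue decomposition then identifies
the density of the remaining product. -/
lemma rootDensity_prod (P P₀ : Measure Ω) (Q Q₀ : Measure Ω') [IsProbabilityMeasure P]
    [IsProbabilityMeasure P₀] [IsProbabilityMeasure Q] [IsProbabilityMeasure Q₀] :
    rootDensity (P.prod Q) (P₀.prod Q₀) =ᵐ[P₀.prod Q₀]
      fun z => rootDensity P P₀ z.1 * rootDensity Q Q₀ z.2 := by
  have hP := P.singularPart_add_rnDeriv P₀
  have hQ := Q.singularPart_add_rnDeriv Q₀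
  have hms : ((P.singularPart P₀).prod Q + (P₀.withDensity (P.rnDeriv P₀)).prod
      (Q.singularPart Q₀)) ⟂ₘ (P₀.prod Q₀) := by
    refine Measure.MutuallySingular.add_left ?_ ?_
    · obtain ⟨s, hs, h1, h2⟩ := P.mutuallySingular_singularPart P₀
      refine ⟨s ×ˢ Set.univ, hs.prod .univ, by simp [h1], ?_⟩
      rw [show (s ×ˢ (Set.univ : Set Ω'))ᶜ = sᶜ ×ˢ Set.univ by ext; simp]
      simp [h2]
    · obtain ⟨s, hs, h1, h2⟩ := Q.mutuallySingular_singularPart Q₀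
      refine ⟨Set.univ ×ˢ s, MeasurableSet.univ.prod hs, by simp [h1], ?_⟩
      rw [show ((Set.univ : Set Ω) ×ˢ s)ᶜ = Set.univ ×ˢ sᶜ by ext; simp]
      simp [h2]
  have hadd : P.prod Q = ((P.singularPart P₀).prod Q + (P₀.withDensity (P.rnDeriv P₀)).prod
      (Q.singularPart Q₀)) + (P₀.prod Q₀).withDensity
        (fun z => P.rnDeriv P₀ z.1 * Q.rnDeriv Q₀ z.2) := by
    rw [← prod_withDensity (P.measurable_rnDeriv P₀) (Q.measurable_rnDeriv Q₀), add_assoc,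
      ← Measure.prod_add, hQ, ← Measure.add_prod, hP]
  have h := Measure.eq_rnDeriv (((P.measurable_rnDeriv P₀).comp measurable_fst).mul
    ((Q.measurable_rnDeriv Q₀).comp measurable_snd)) hms hadd
  filter_upwards [h] with z hz
  simp only [rootDensity]
  rw [← hz]
  simp [Real.sqrt_mul]

lemma densityQuotient_ae_eq (P Q : ProbabilityMeasure Ω) :
    (fun ω => √(densityQuotient P Q ω).toReal) =ᵐ[(Q : Measure Ω)]
      rootDensity (P : Measure Ω) (Q : Measure Ω) := by
  filter_upwards [Measure.rnDeriv_eq_div_rnDeriv_add (P : Measure Ω) (Q : Measure Ω)] with ω hω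
  simp only [rootDensity, densityQuotient, hω]

lemma measurable_densityQuotient (P Q : ProbabilityMeasure Ω) :
    Measurable (densityQuotient P Q) :=
  (Measure.measurable_rnDeriv _ _).div (Measure.measurable_rnDeriv _ _)

/-- The left side is the mass of the singular part, carried by a `Q`-null set `sᶜ`. There the
density of `Q` vanishes `(P + Q)`-a.e., so the quotient is infinite `P`-a.e. on `sᶜ`. -/
lemma one_sub_integral_rootDensity_sq_le (P Q : ProbabilityMeasure Ω) :
    1 - ∫ ω, rootDensity (P : Measure Ω) (Q : Measure Ω) ω ^ 2 ∂(Q : Measure Ω) ≤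
      (P : Measure Ω).real {ω | densityQuotient P Q ω = ∞} := by
  set μ : Measure Ω := (P : Measure Ω) with hμ
  set ν : Measure Ω := (Q : Measure Ω) with hν
  obtain ⟨s, hs, h1, h2⟩ := μ.mutuallySingular_singularPart ν
  rw [integral_rootDensity_sq, sub_sub_cancel]
  have hPac : μ ≪ μ + ν := rfl.absolutelyContinuous.add_right _
  have hQac : ν ≪ μ + ν := rfl.absolutelyContinuous.add_right' _
  have hP : μ (sᶜ ∩ {ω | densityQuotient P Q ω ≠ ∞}) = 0 := by
    have hq : ∫⁻ ω in sᶜ, ν.rnDeriv (μ + ν) ω ∂(μ + ν) = 0 := by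
      rw [Measure.setLIntegral_rnDeriv hQac]; exact h2
    rw [lintegral_eq_zero_iff (Measure.measurable_rnDeriv _ _)] at hq
    have hq' := (ae_restrict_iff' hs.compl).1 hq
    have hm : MeasurableSet (sᶜ ∩ {ω | densityQuotient P Q ω ≠ ∞}) :=
      hs.compl.inter ((measurable_densityQuotient P Q) (measurableSet_singleton ∞).compl)
    rw [← Measure.setLIntegral_rnDeriv hPac, lintegral_eq_zero_iff (Measure.measurable_rnDeriv _ _)]
    refine (ae_restrict_iff' hm).2 ?_
    filter_upwards [hq'] with ω hω hmem
    have h0 := hω hmem.1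
    by_contra hne
    refine hmem.2 ?_
    have hne' : μ.rnDeriv (μ + ν) ω ≠ 0 := hne
    have h0' : ν.rnDeriv (μ + ν) ω = 0 := h0
    change μ.rnDeriv (μ + ν) ω / ν.rnDeriv (μ + ν) ω = ∞
    rw [h0', ENNReal.div_zero hne']
  have hle : (μ.singularPart ν) Set.univ ≤ μ {ω | densityQuotient P Q ω = ∞} := by
    calc (μ.singularPart ν) Set.univ ≤ (μ.singularPart ν) s + (μ.singularPart ν) sᶜ := by
          rw [← Set.union_compl_self s]; exact measure_union_le _ _
      _ = (μ.singularPart ν) sᶜ := by rw [h1, zero_add]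
      _ ≤ μ sᶜ := Measure.singularPart_le _ _ _
      _ ≤ μ (sᶜ ∩ {ω | densityQuotient P Q ω ≠ ∞}) + μ {ω | densityQuotient P Q ω = ∞} := by
          refine (measure_mono ?_).trans (measure_union_le _ _)
          intro ω hω
          by_cases h : densityQuotient P Q ω = ∞
          · exact Or.inr h
          · exact Or.inl ⟨hω, h⟩
      _ = _ := by rw [hP, zero_add]
  exact ENNReal.toReal_mono (measure_ne_top _ _) hle

end RootDensity

/-! ### Cauchy–Schwarz and elementary `L₂` inequalities. -/

section CauchySchwarz

variable {Ω : Type*} [MeasurableSpace Ω] {μ : Measure Ω}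

lemma sq_integral_mul_le {f g : Ω → ℝ} (hf : MemLp f 2 μ) (hg : MemLp g 2 μ) :
    (∫ ω, f ω * g ω ∂μ) ^ 2 ≤ (∫ ω, f ω ^ 2 ∂μ) * ∫ ω, g ω ^ 2 ∂μ := by
  have hfg : Integrable (fun ω => f ω * g ω) μ := hf.integrable_mul hg
  -- The quadratic polynomial `x ↦ ∫ (x f + g)²` is nonnegative, so its discriminant is at most
  -- zero.
  have key : ∀ x : ℝ, 0 ≤ (∫ ω, f ω ^ 2 ∂μ) * (x * x) + (2 * ∫ ω, f ω * g ω ∂μ) * x +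
      ∫ ω, g ω ^ 2 ∂μ := by
    intro x
    have h : ∫ ω, (x * f ω + g ω) ^ 2 ∂μ = (∫ ω, f ω ^ 2 ∂μ) * (x * x) +
        (2 * ∫ ω, f ω * g ω ∂μ) * x + ∫ ω, g ω ^ 2 ∂μ := by
      have e : ∀ ω, (x * f ω + g ω) ^ 2 = x * x * f ω ^ 2 + 2 * x * (f ω * g ω) + g ω ^ 2 :=
        fun ω => by ring
      simp_rw [e]
      have i1 : Integrable (fun ω => x * x * f ω ^ 2) μ := hf.integrable_sq.const_mul _
      have i2 : Integrable (fun ω => 2 * x * (f ω * g ω)) μ := hfg.const_mul _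
      rw [integral_add (by exact i1.add i2) hg.integrable_sq, integral_add i1 i2,
        integral_const_mul, integral_const_mul]
      ring
    rw [← h]
    exact integral_nonneg fun ω => sq_nonneg _
  have := discrim_le_zero key
  unfold discrim at this
  linarith

lemma integral_abs_mul_le {f g : Ω → ℝ} (hf : MemLp f 2 μ) (hg : MemLp g 2 μ) :
    ∫ ω, |f ω * g ω| ∂μ ≤ √(∫ ω, f ω ^ 2 ∂μ) * √(∫ ω, g ω ^ 2 ∂μ) := by
  have h := sq_integral_mul_le hf.abs hg.abs
  simp only [Pi.abs_apply, sq_abs] at h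
  simp_rw [abs_mul]
  rw [← Real.sqrt_mul (integral_nonneg fun ω => sq_nonneg _)]
  exact Real.le_sqrt_of_sq_le h

lemma integral_sq_add_le {f g : Ω → ℝ} (hf : MemLp f 2 μ) (hg : MemLp g 2 μ) :
    ∫ ω, (f ω + g ω) ^ 2 ∂μ ≤ 2 * (∫ ω, f ω ^ 2 ∂μ) + 2 * ∫ ω, g ω ^ 2 ∂μ := by
  rw [← integral_const_mul, ← integral_const_mul,
    ← integral_add (hf.integrable_sq.const_mul _) (hg.integrable_sq.const_mul _)]
  refine integral_mono (hf.add hg).integrable_sq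
    ((hf.integrable_sq.const_mul _).add (hg.integrable_sq.const_mul _)) fun ω => ?_
  dsimp only
  nlinarith [sq_nonneg (f ω - g ω)]

lemma sq_integral_le [IsProbabilityMeasure μ] {f : Ω → ℝ} (hf : MemLp f 2 μ) :
    (∫ ω, f ω ∂μ) ^ 2 ≤ ∫ ω, f ω ^ 2 ∂μ := by
  simpa using sq_integral_mul_le hf (memLp_const (1 : ℝ))

lemma toReal_eLpNorm_two_sq {f : Ω → ℝ} (hf : MemLp f 2 μ) :
    (eLpNorm f 2 μ).toReal ^ 2 = ∫ ω, f ω ^ 2 ∂μ := by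
  rw [hf.eLpNorm_eq_integral_rpow_norm (by simp) (by simp), ENNReal.toReal_ofReal (by positivity)]
  have h0 : 0 ≤ ∫ ω, f ω ^ 2 ∂μ := integral_nonneg fun ω => sq_nonneg _
  simp only [ENNReal.toReal_ofNat, Real.norm_eq_abs, Real.rpow_ofNat, sq_abs]
  rw [← Real.rpow_natCast, ← Real.rpow_mul h0]
  norm_num

end CauchySchwarz

/-! ### Partial integration in `L₂` of a product measure. -/

section ProductL2

variable {Ω Ω' : Type*} [MeasurableSpace Ω] [MeasurableSpace Ω'] {μ : Measure Ω} {ν : Measure Ω'}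

lemma ae_memLp_two_prod_right [SFinite μ] [SFinite ν] {g : Ω × Ω' → ℝ} (hg : MemLp g 2 (μ.prod ν)) :
    ∀ᵐ x ∂μ, MemLp (fun y => g (x, y)) 2 ν := by
  filter_upwards [hg.1.prodMk_left, hg.integrable_sq.prod_right_ae] with x hx hx'
  exact (memLp_two_iff_integrable_sq hx).2 hx'

lemma ae_sq_integral_prod_right_le [SFinite μ] [IsProbabilityMeasure ν] {g : Ω × Ω' → ℝ}
    (hg : MemLp g 2 (μ.prod ν)) :
    ∀ᵐ x ∂μ, (∫ y, g (x, y) ∂ν) ^ 2 ≤ ∫ y, g (x, y) ^ 2 ∂ν := by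
  filter_upwards [ae_memLp_two_prod_right hg] with x hx
  exact sq_integral_le hx

lemma memLp_two_integral_prod_right [SFinite μ] [IsProbabilityMeasure ν] {g : Ω × Ω' → ℝ}
    (hg : MemLp g 2 (μ.prod ν)) : MemLp (fun x => ∫ y, g (x, y) ∂ν) 2 μ := by
  have hm : AEStronglyMeasurable (fun x => ∫ y, g (x, y) ∂ν) μ := hg.1.integral_prod_right'
  refine (memLp_two_iff_integrable_sq hm).2 ?_
  refine hg.integrable_sq.integral_prod_left.mono (hm.pow 2) ?_
  filter_upwards [ae_sq_integral_prod_right_le hg] with x hx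
  rw [Real.norm_of_nonneg (sq_nonneg _)]
  exact hx.trans (Real.le_norm_self _)

/-- Averaging over one coordinate is an `L₂`-contraction; this is what transfers remainder bounds
from product curves to their marginals. -/
lemma integral_sq_integral_prod_right_le [SFinite μ] [IsProbabilityMeasure ν] {g : Ω × Ω' → ℝ}
    (hg : MemLp g 2 (μ.prod ν)) :
    ∫ x, (∫ y, g (x, y) ∂ν) ^ 2 ∂μ ≤ ∫ z, g z ^ 2 ∂(μ.prod ν) := by
  rw [integral_prod _ hg.integrable_sq]
  exact integral_mono_ae (memLp_two_integral_prod_right hg).integrable_sq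
    hg.integrable_sq.integral_prod_left (ae_sq_integral_prod_right_le hg)

lemma memLp_comp_fst [IsProbabilityMeasure μ] [IsProbabilityMeasure ν] {f : Ω → ℝ}
    (hf : MemLp f 2 μ) : MemLp (fun z : Ω × Ω' => f z.1) 2 (μ.prod ν) :=
  hf.comp_measurePreserving measurePreserving_fst

lemma memLp_comp_snd [IsProbabilityMeasure μ] [IsProbabilityMeasure ν] {f : Ω' → ℝ}
    (hf : MemLp f 2 ν) : MemLp (fun z : Ω × Ω' => f z.2) 2 (μ.prod ν) :=
  hf.comp_measurePreserving measurePreserving_snd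

lemma memLp_two_mul_prod [IsProbabilityMeasure μ] [IsProbabilityMeasure ν] {f : Ω → ℝ}
    {h : Ω' → ℝ} (hf : MemLp f 2 μ) (hh : MemLp h 2 ν) :
    MemLp (fun z : Ω × Ω' => f z.1 * h z.2) 2 (μ.prod ν) := by
  have hm : AEStronglyMeasurable (fun z : Ω × Ω' => f z.1 * h z.2) (μ.prod ν) :=
    (memLp_comp_fst hf).1.mul (memLp_comp_snd hh).1
  refine (memLp_two_iff_integrable_sq hm).2 ?_
  have e : ∀ z : Ω × Ω', (f z.1 * h z.2) ^ 2 = f z.1 ^ 2 * h z.2 ^ 2 := fun z => mul_pow _ _ _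
  simp only [e]
  exact hf.integrable_sq.mul_prod hh.integrable_sq

lemma integral_fst_mul [IsProbabilityMeasure μ] [IsProbabilityMeasure ν] {f : Ω → ℝ}
    {r : Ω × Ω' → ℝ} (hf : MemLp f 2 μ) (hr : MemLp r 2 (μ.prod ν)) :
    ∫ z, f z.1 * r z ∂(μ.prod ν) = ∫ x, f x * ∫ y, r (x, y) ∂ν ∂μ := by
  have := integral_prod _ ((memLp_comp_fst (ν := ν) hf).integrable_mul hr)
  simp only [Pi.mul_apply] at this
  rw [this]
  simp_rw [integral_const_mul]

lemma integral_snd_mul [IsProbabilityMeasure μ] [IsProbabilityMeasure ν] {f : Ω' → ℝ}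
    {r : Ω × Ω' → ℝ} (hf : MemLp f 2 ν) (hr : MemLp r 2 (μ.prod ν)) :
    ∫ z, f z.2 * r z ∂(μ.prod ν) = ∫ y, f y * ∫ x, r (x, y) ∂μ ∂ν := by
  have := integral_prod_symm _ ((memLp_comp_snd (μ := μ) hf).integrable_mul hr)
  simp only [Pi.mul_apply] at this
  rw [this]
  simp_rw [integral_const_mul]

end ProductL2

/-! ### Scores of curves, and of the marginals of product curves. -/

section Score

variable {Ω Ω' : Type*} [MeasurableSpace Ω] [MeasurableSpace Ω']

/-- `g` is the score at `0` of the curve `P` around `P₀`: the root densities are differentiable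
in quadratic mean, and the mass of the singular parts is negligible. -/
structure HasScore (P : ℝ → Measure Ω) (P₀ : Measure Ω) (g : Ω → ℝ) : Prop where
  memLp : MemLp g 2 P₀
  remainder : (fun t : ℝ => ∫ ω, (2 * (rootDensity (P t) P₀ ω - 1) - t * g ω) ^ 2 ∂P₀)
    =o[𝓝[≠] 0] fun t : ℝ => t ^ 2
  singular : (fun t : ℝ => 1 - ∫ ω, rootDensity (P t) P₀ ω ^ 2 ∂P₀)
    =o[𝓝[≠] 0] fun t : ℝ => t ^ 2

lemma memLp_rootDensity_sub_one (P P₀ : Measure Ω) [IsProbabilityMeasure P]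
    [IsProbabilityMeasure P₀] : MemLp (fun ω => rootDensity P P₀ ω - 1) 2 P₀ :=
  (memLp_rootDensity P P₀).sub (memLp_const 1)

lemma memLp_score_remainder (P P₀ : Measure Ω) [IsProbabilityMeasure P] [IsProbabilityMeasure P₀]
    {g : Ω → ℝ} (hg : MemLp g 2 P₀) (t : ℝ) :
    MemLp (fun ω => 2 * (rootDensity P P₀ ω - 1) - t * g ω) 2 P₀ :=
  ((memLp_rootDensity_sub_one P P₀).const_mul 2).sub (hg.const_mul t)

lemma IsL2DiffCurve.hasScore {F : Set (ProbabilityMeasure Ω)} {γ : ℝ → ProbabilityMeasure Ω}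
    {g : Ω → ℝ} (h : IsL2DiffCurve F γ g) :
    HasScore (fun t => (γ t : Measure Ω)) (γ 0 : Measure Ω) g where
  memLp := h.memLp
  remainder := by
    have h2 := h.norm_isLittleO.pow (n := 2) (by norm_num)
    refine (h2.congr_left fun t => ?_).congr_right fun t => sq_abs t
    rw [eLpNorm_congr_ae (g := fun ω => 2 * (rootDensity (γ t : Measure Ω) (γ 0 : Measure Ω) ω - 1)
      - t * g ω), toReal_eLpNorm_two_sq (memLp_score_remainder _ _ h.memLp t)]
    filter_upwards [densityQuotient_ae_eq (γ t) (γ 0)] with ω hω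
    rw [hω]
  singular := by
    refine IsBigO.trans_isLittleO (IsBigO.of_norm_le fun t => ?_) h.singular_isLittleO
    rw [Real.norm_of_nonneg (sub_nonneg.2 (integral_rootDensity_sq_le _ _))]
    exact one_sub_integral_rootDensity_sq_le _ _

lemma HasScore.congr {P P' : ℝ → Measure Ω} {P₀ : Measure Ω} {g : Ω → ℝ} (h : HasScore P P₀ g)
    (hPP' : P =ᶠ[𝓝[≠] 0] P') : HasScore P' P₀ g where
  memLp := h.memLp
  remainder := h.remainder.congr' (hPP'.mono fun t ht => by simp only [ht]) .rfl
  singular := h.singular.congr' (hPP'.mono fun t ht => by simp only [ht]) .rfl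

/-- `2(ρ - 1)` is the remainder plus `t g`, of `L₂`-norms `o(t)` and `O(t)`. -/
lemma HasScore.isBigO_sub_one {P : ℝ → Measure Ω} {P₀ : Measure Ω} {g : Ω → ℝ}
    [∀ t, IsProbabilityMeasure (P t)] [IsProbabilityMeasure P₀] (h : HasScore P P₀ g) :
    (fun t => ∫ ω, (rootDensity (P t) P₀ ω - 1) ^ 2 ∂P₀) =O[𝓝[≠] 0] fun t : ℝ => t ^ 2 := by
  have h1 : (fun t : ℝ => 2 * ∫ ω, (2 * (rootDensity (P t) P₀ ω - 1) - t * g ω) ^ 2 ∂P₀ +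
      2 * ∫ ω, (t * g ω) ^ 2 ∂P₀) =O[𝓝[≠] 0] fun t : ℝ => t ^ 2 := by
    refine (h.remainder.isBigO.const_mul_left 2).add ?_
    simp_rw [mul_pow, integral_const_mul]
    refine IsBigO.const_mul_left ?_ 2
    simp_rw [mul_comm _ (∫ ω, g ω ^ 2 ∂P₀)]
    exact (isBigO_refl _ _).const_mul_left _
  refine IsBigO.trans (IsBigO.of_norm_le fun t => ?_) h1
  rw [Real.norm_of_nonneg (integral_nonneg fun ω => sq_nonneg _)]
  refine le_trans ?_ (integral_sq_add_le (memLp_score_remainder (P t) P₀ h.memLp t)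
    (h.memLp.const_mul t))
  simp_rw [sub_add_cancel, mul_pow, integral_const_mul]
  have h0 : 0 ≤ ∫ ω, (rootDensity (P t) P₀ ω - 1) ^ 2 ∂P₀ := integral_nonneg fun ω => sq_nonneg _
  linarith

variable {P : ℝ → Measure Ω} {P₀ : Measure Ω} {Q : ℝ → Measure Ω'} {Q₀ : Measure Ω'}
  {g : Ω × Ω' → ℝ} [∀ t, IsProbabilityMeasure (P t)] [∀ t, IsProbabilityMeasure (Q t)]
  [IsProbabilityMeasure P₀] [IsProbabilityMeasure Q₀]

lemma integral_rootDensity_prod_sq (P P₀ : Measure Ω) (Q Q₀ : Measure Ω') [IsProbabilityMeasure P]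
    [IsProbabilityMeasure P₀] [IsProbabilityMeasure Q] [IsProbabilityMeasure Q₀] :
    ∫ z, rootDensity (P.prod Q) (P₀.prod Q₀) z ^ 2 ∂(P₀.prod Q₀) =
      (∫ x, rootDensity P P₀ x ^ 2 ∂P₀) * ∫ y, rootDensity Q Q₀ y ^ 2 ∂Q₀ := by
  rw [← integral_prod_mul]
  refine integral_congr_ae ?_
  filter_upwards [rootDensity_prod P P₀ Q Q₀] with z hz
  rw [hz, mul_pow]

lemma HasScore.swap (h : HasScore (fun t => (P t).prod (Q t)) (P₀.prod Q₀) g) :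
    HasScore (fun t => (Q t).prod (P t)) (Q₀.prod P₀) (g ∘ Prod.swap) where
  memLp := h.memLp.comp_measurePreserving Measure.measurePreserving_swap
  remainder := by
    refine h.remainder.congr_left fun t => ?_
    rw [← integral_prod_swap]
    refine integral_congr_ae ?_
    filter_upwards [rootDensity_prod (Q t) Q₀ (P t) P₀,
      Measure.measurePreserving_swap.quasiMeasurePreserving.ae (rootDensity_prod (P t) P₀ (Q t) Q₀)]
      with z hz hz'
    rw [hz, hz']
    simp only [Prod.fst_swap, Prod.snd_swap, Function.comp_apply]
    rw [mul_comm (rootDensity (P t) P₀ z.2)]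
  singular := by
    refine h.singular.congr_left fun t => ?_
    rw [integral_rootDensity_prod_sq, integral_rootDensity_prod_sq, mul_comm]

lemma integral_rootDensity_nonneg (P P₀ : Measure Ω) : 0 ≤ ∫ x, rootDensity P P₀ x ∂P₀ :=
  integral_nonneg fun _ => rootDensity_nonneg _ _ _

lemma integral_rootDensity_le_one (P P₀ : Measure Ω) [IsProbabilityMeasure P]
    [IsProbabilityMeasure P₀] : ∫ x, rootDensity P P₀ x ∂P₀ ≤ 1 := by
  have h1 := sq_integral_le (memLp_rootDensity P P₀)
  have h2 := integral_rootDensity_sq_le P P₀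
  nlinarith

/-- With `α`, `β` the integrals of the two root densities, both in `[0, 1]`, the right side equals
`2 - 2αβ`, which dominates `1 - β`. The gain is that `1 - β` is of second order in `t`, although `ρ
- 1` is only of first order. -/
lemma one_sub_integral_rootDensity_le (P P₀ : Measure Ω) (Q Q₀ : Measure Ω')
    [IsProbabilityMeasure P] [IsProbabilityMeasure P₀] [IsProbabilityMeasure Q]
    [IsProbabilityMeasure Q₀] :
    1 - ∫ y, rootDensity Q Q₀ y ∂Q₀ ≤
      ∫ z, (rootDensity (P.prod Q) (P₀.prod Q₀) z - 1) ^ 2 ∂(P₀.prod Q₀) +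
      (1 - ∫ z, rootDensity (P.prod Q) (P₀.prod Q₀) z ^ 2 ∂(P₀.prod Q₀)) := by
  have hab := memLp_rootDensity (P.prod Q) (P₀.prod Q₀)
  have h1 : ∫ z, rootDensity (P.prod Q) (P₀.prod Q₀) z ∂(P₀.prod Q₀) =
      (∫ x, rootDensity P P₀ x ∂P₀) * ∫ y, rootDensity Q Q₀ y ∂Q₀ := by
    rw [← integral_prod_mul]
    exact integral_congr_ae (rootDensity_prod P P₀ Q Q₀)
  have h2 : ∫ z, (rootDensity (P.prod Q) (P₀.prod Q₀) z - 1) ^ 2 ∂(P₀.prod Q₀) =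
      ∫ z, rootDensity (P.prod Q) (P₀.prod Q₀) z ^ 2 ∂(P₀.prod Q₀) -
      2 * ∫ z, rootDensity (P.prod Q) (P₀.prod Q₀) z ∂(P₀.prod Q₀) + 1 := by
    have e : ∀ z, (rootDensity (P.prod Q) (P₀.prod Q₀) z - 1) ^ 2 =
        rootDensity (P.prod Q) (P₀.prod Q₀) z ^ 2 -
          2 * rootDensity (P.prod Q) (P₀.prod Q₀) z + 1 := fun z => by ring
    simp_rw [e]
    have i1 := (hab.integrable (by norm_num)).const_mul 2
    rw [integral_add (by exact hab.integrable_sq.sub i1) (integrable_const _),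
      integral_sub hab.integrable_sq i1, integral_const_mul]
    simp
  rw [h2, h1]
  have hα := integral_rootDensity_le_one P P₀
  have hα0 := integral_rootDensity_nonneg P P₀
  have hβ := integral_rootDensity_le_one Q Q₀
  have hβ0 := integral_rootDensity_nonneg Q Q₀
  nlinarith

/-- Integrating the product remainder over `y` gives `2(aβ - 1) - t g₁`; replacing `β` by `1` costs
`2(1 - β)a` with `∫ a² ≤ 1`. The factors are those of `(u + v)² ≤ 2u² + 2v²`, with `8 = 2 · 2²`. -/
lemma integral_sq_score_remainder_fst_le (P P₀ : Measure Ω) (Q Q₀ : Measure Ω')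
    [IsProbabilityMeasure P] [IsProbabilityMeasure P₀] [IsProbabilityMeasure Q]
    [IsProbabilityMeasure Q₀] (hg : MemLp g 2 (P₀.prod Q₀)) (t : ℝ) :
    ∫ x, (2 * (rootDensity P P₀ x - 1) - t * ∫ y, g (x, y) ∂Q₀) ^ 2 ∂P₀ ≤
      2 * ∫ z, (2 * (rootDensity (P.prod Q) (P₀.prod Q₀) z - 1) - t * g z) ^ 2 ∂(P₀.prod Q₀) +
      8 * (1 - ∫ y, rootDensity Q Q₀ y ∂Q₀) ^ 2 := by
  set β := ∫ y, rootDensity Q Q₀ y ∂Q₀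
  have ha := memLp_rootDensity P P₀
  have hb := memLp_rootDensity Q Q₀
  have hab : MemLp (fun z : Ω × Ω' => 2 * (rootDensity P P₀ z.1 * rootDensity Q Q₀ z.2 - 1)
      - t * g z) 2 (P₀.prod Q₀) :=
    (((memLp_two_mul_prod ha hb).sub (memLp_const 1)).const_mul 2).sub (hg.const_mul t)
  have h1 : ∫ z, (2 * (rootDensity (P.prod Q) (P₀.prod Q₀) z - 1) - t * g z) ^ 2 ∂(P₀.prod Q₀)
      = ∫ z, (2 * (rootDensity P P₀ z.1 * rootDensity Q Q₀ z.2 - 1) - t * g z) ^ 2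
        ∂(P₀.prod Q₀) := by
    refine integral_congr_ae ?_
    filter_upwards [rootDensity_prod P P₀ Q Q₀] with z hz
    rw [hz]
  have h2 := integral_sq_integral_prod_right_le hab
  have h3 : ∀ᵐ x ∂P₀, ∫ y, (2 * (rootDensity P P₀ x * rootDensity Q Q₀ y - 1) - t * g (x, y)) ∂Q₀
      = 2 * (rootDensity P P₀ x * β - 1) - t * ∫ y, g (x, y) ∂Q₀ := by
    filter_upwards [ae_memLp_two_prod_right hg] with x hx
    have i1 : Integrable (fun y => rootDensity P P₀ x * rootDensity Q Q₀ y) Q₀ :=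
      (hb.integrable (by norm_num)).const_mul _
    have i2 : Integrable (fun y => 2 * (rootDensity P P₀ x * rootDensity Q Q₀ y - 1)) Q₀ :=
      (i1.sub (integrable_const 1)).const_mul _
    rw [integral_sub i2 ((hx.integrable (by norm_num)).const_mul _), integral_const_mul,
      integral_sub i1 (integrable_const 1), integral_const_mul, integral_const_mul]
    simp [β]
  have hm := memLp_two_integral_prod_right hab
  have h4 : ∫ x, (2 * (rootDensity P P₀ x - 1) - t * ∫ y, g (x, y) ∂Q₀) ^ 2 ∂P₀ =
      ∫ x, ((∫ y, (2 * (rootDensity P P₀ x * rootDensity Q Q₀ y - 1) - t * g (x, y)) ∂Q₀) +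
        2 * (1 - β) * rootDensity P P₀ x) ^ 2 ∂P₀ := by
    refine integral_congr_ae ?_
    filter_upwards [h3] with x hx
    rw [hx]
    ring
  rw [h1, h4]
  refine (integral_sq_add_le hm (ha.const_mul (2 * (1 - β)))).trans ?_
  have h5 := integral_rootDensity_sq_le P P₀
  simp_rw [mul_pow _ (rootDensity P P₀ _), integral_const_mul]
  nlinarith [sq_nonneg (1 - β)]

lemma HasScore.fst (h : HasScore (fun t => (P t).prod (Q t)) (P₀.prod Q₀) g) :
    HasScore P P₀ (fun x => ∫ y, g (x, y) ∂Q₀) where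
  memLp := memLp_two_integral_prod_right h.memLp
  remainder := by
    have hβ : (fun t => 1 - ∫ y, rootDensity (Q t) Q₀ y ∂Q₀) =O[𝓝[≠] 0] fun t : ℝ => t ^ 2 := by
      refine IsBigO.trans (IsBigO.of_norm_le fun t => ?_)
        (h.isBigO_sub_one.add h.singular.isBigO)
      rw [Real.norm_of_nonneg (sub_nonneg.2 (integral_rootDensity_le_one _ _))]
      exact one_sub_integral_rootDensity_le _ _ _ _
    -- Since `1 - β = O(t²)`, its square is `O(t⁴)`.
    have hβ2 : (fun t => (1 - ∫ y, rootDensity (Q t) Q₀ y ∂Q₀) ^ 2) =o[𝓝[≠] 0]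
        fun t : ℝ => t ^ 2 := by
      refine (hβ.pow 2).trans_isLittleO ?_
      have : (fun t : ℝ => (t ^ 2) ^ 2) = fun t : ℝ => t ^ 4 := by ext; ring
      rw [this]
      exact (isLittleO_pow_pow (by norm_num)).mono nhdsWithin_le_nhds
    refine IsBigO.trans_isLittleO (IsBigO.of_norm_le fun t => ?_)
      ((h.remainder.const_mul_left 2).add (hβ2.const_mul_left 8))
    rw [Real.norm_of_nonneg (integral_nonneg fun ω => sq_nonneg _)]
    exact integral_sq_score_remainder_fst_le _ _ _ _ h.memLp t
  singular := by
    refine IsBigO.trans_isLittleO (IsBigO.of_norm_le fun t => ?_) h.singular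
    have h1 := integral_rootDensity_sq_le (P t) P₀
    have h2 := integral_rootDensity_sq_le (Q t) Q₀
    have h3 : 0 ≤ ∫ x, rootDensity (P t) P₀ x ^ 2 ∂P₀ := integral_nonneg fun _ => sq_nonneg _
    rw [integral_rootDensity_prod_sq, Real.norm_of_nonneg (by linarith)]
    nlinarith

lemma HasScore.snd (h : HasScore (fun t => (P t).prod (Q t)) (P₀.prod Q₀) g) :
    HasScore Q Q₀ (fun y => ∫ x, g (x, y) ∂P₀) := h.swap.fst

/-- In `ab - 1 = (a - 1) + (b - 1) + (a - 1)(b - 1)` the first two terms integrate to zero against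
`r` and the third has `L₂`-norm `O(t²)`. Hence `t ∫ r g = o(t)`, which forces the constant to
vanish. -/
lemma HasScore.integral_mul_eq_zero (h : HasScore (fun t => (P t).prod (Q t)) (P₀.prod Q₀) g)
    {r : Ω × Ω' → ℝ} (hr : MemLp r 2 (P₀.prod Q₀)) (hr₁ : ∀ᵐ x ∂P₀, ∫ y, r (x, y) ∂Q₀ = 0)
    (hr₂ : ∀ᵐ y ∂Q₀, ∫ x, r (x, y) ∂P₀ = 0) : ∫ z, r z * g z ∂(P₀.prod Q₀) = 0 := by
  set C := ∫ z, r z ^ 2 ∂(P₀.prod Q₀)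
  have hC : 0 ≤ C := integral_nonneg fun _ => sq_nonneg _
  have key : ∀ t : ℝ, t ^ 2 * (∫ z, r z * g z ∂(P₀.prod Q₀)) ^ 2 ≤
      8 * C * ((∫ x, (rootDensity (P t) P₀ x - 1) ^ 2 ∂P₀) *
        ∫ y, (rootDensity (Q t) Q₀ y - 1) ^ 2 ∂Q₀) +
      2 * C * ∫ z, (2 * (rootDensity ((P t).prod (Q t)) (P₀.prod Q₀) z - 1) - t * g z) ^ 2
        ∂(P₀.prod Q₀) := by
    intro t
    have ha := memLp_rootDensity_sub_one (P t) P₀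
    have hb := memLp_rootDensity_sub_one (Q t) Q₀
    have hab := memLp_two_mul_prod ha hb
    have hρ := memLp_score_remainder ((P t).prod (Q t)) (P₀.prod Q₀) h.memLp t
    have e : ∫ z, r z * (t * g z) ∂(P₀.prod Q₀) =
        2 * (∫ z, r z * ((rootDensity (P t) P₀ z.1 - 1) * (rootDensity (Q t) Q₀ z.2 - 1))
          ∂(P₀.prod Q₀)) -
        ∫ z, r z * (2 * (rootDensity ((P t).prod (Q t)) (P₀.prod Q₀) z - 1) - t * g z)
          ∂(P₀.prod Q₀) := by
      have e1 : ∫ z : Ω × Ω', (rootDensity (P t) P₀ z.1 - 1) * r z ∂(P₀.prod Q₀) = 0 := by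
        rw [integral_fst_mul ha hr]
        refine integral_eq_zero_of_ae ?_
        filter_upwards [hr₁] with x hx
        simp [hx]
      have e2 : ∫ z : Ω × Ω', (rootDensity (Q t) Q₀ z.2 - 1) * r z ∂(P₀.prod Q₀) = 0 := by
        rw [integral_snd_mul hb hr]
        refine integral_eq_zero_of_ae ?_
        filter_upwards [hr₂] with x hx
        simp [hx]
      have i1 := (memLp_comp_fst (ν := Q₀) ha).integrable_mul hr
      have i2 := (memLp_comp_snd (μ := P₀) hb).integrable_mul hr
      have i3 := hr.integrable_mul hab
      have i4 := hr.integrable_mul hρ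
      have e3 : ∫ z, r z * (t * g z) ∂(P₀.prod Q₀) = ∫ z,
          (2 * (r z * ((rootDensity (P t) P₀ z.1 - 1) * (rootDensity (Q t) Q₀ z.2 - 1))) -
          r z * (2 * (rootDensity ((P t).prod (Q t)) (P₀.prod Q₀) z - 1) - t * g z) +
          (2 * ((rootDensity (P t) P₀ z.1 - 1) * r z) +
            2 * ((rootDensity (Q t) Q₀ z.2 - 1) * r z))) ∂(P₀.prod Q₀) := by
        refine integral_congr_ae ?_
        filter_upwards [rootDensity_prod (P t) P₀ (Q t) Q₀] with z hz
        rw [hz]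
        ring
      rw [e3, integral_add (by exact (i3.const_mul 2).sub i4)
        (by exact (i1.const_mul 2).add (i2.const_mul 2)),
        integral_sub (by exact i3.const_mul 2) (by exact i4),
        integral_add (by exact i1.const_mul 2) (by exact i2.const_mul 2),
        integral_const_mul, integral_const_mul, integral_const_mul, e1, e2]
      ring
    have c1 := sq_integral_mul_le hr hab
    have c2 := sq_integral_mul_le hr hρ
    simp_rw [mul_pow (rootDensity (P t) P₀ _ - 1)] at c1
    rw [integral_prod_mul (fun x => (rootDensity (P t) P₀ x - 1) ^ 2)
      (fun y => (rootDensity (Q t) Q₀ y - 1) ^ 2)] at c1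
    simp_rw [mul_left_comm _ t, integral_const_mul] at e
    rw [← mul_pow, e]
    set A := ∫ z, r z * ((rootDensity (P t) P₀ z.1 - 1) * (rootDensity (Q t) Q₀ z.2 - 1))
          ∂(P₀.prod Q₀)
    set B := ∫ z, r z * (2 * (rootDensity ((P t).prod (Q t)) (P₀.prod Q₀) z - 1) - t * g z)
          ∂(P₀.prod Q₀)
    -- `(2A - B)² ≤ 8A² + 2B²`, followed by Cauchy–Schwarz for `A` and for `B`: the origin of `8C`
    -- and `2C`.
    nlinarith [sq_nonneg (2 * A + B)]
  have hab : (fun t => (∫ x, (rootDensity (P t) P₀ x - 1) ^ 2 ∂P₀) *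
        ∫ y, (rootDensity (Q t) Q₀ y - 1) ^ 2 ∂Q₀) =o[𝓝[≠] 0] fun t : ℝ => t ^ 2 := by
    refine (h.fst.isBigO_sub_one.mul h.snd.isBigO_sub_one).trans_isLittleO ?_
    have : (fun t : ℝ => t ^ 2 * t ^ 2) = fun t : ℝ => t ^ 4 := by ext; ring
    rw [this]
    exact (isLittleO_pow_pow (by norm_num)).mono nhdsWithin_le_nhds
  have ho : (fun t : ℝ => t ^ 2 * (∫ z, r z * g z ∂(P₀.prod Q₀)) ^ 2) =o[𝓝[≠] 0]
      fun t : ℝ => t ^ 2 := by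
    refine IsBigO.trans_isLittleO (IsBigO.of_norm_le fun t => ?_)
      ((hab.const_mul_left (8 * C)).add (h.remainder.const_mul_left (2 * C)))
    rw [Real.norm_of_nonneg (by positivity)]
    exact key t
  have hlim := ho.tendsto_div_nhds_zero
  have hconst : Tendsto (fun t : ℝ => t ^ 2 * (∫ z, r z * g z ∂(P₀.prod Q₀)) ^ 2 / t ^ 2) (𝓝[≠] 0)
      (𝓝 ((∫ z, r z * g z ∂(P₀.prod Q₀)) ^ 2)) := by
    refine tendsto_const_nhds.congr' ?_
    filter_upwards [self_mem_nhdsWithin] with t ht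
    have : t ≠ 0 := ht
    field_simp
  exact pow_eq_zero_iff (two_ne_zero) |>.1 (tendsto_nhds_unique hconst hlim)

end Score

/-! ### Expansion of characteristic functions along a curve with a score. -/

section CharFunExpansion

-- Taylor for `|x| ≤ 1`, and `|x| + |x| ≤ 2x²` beyond. Being valid on all of `ℝ`, the bound yields
-- the integrable majorant `3κ²` for dominated convergence.
open Complex in
lemma norm_cexp_I_mul_sub_one_sub_le (x : ℝ) :
    ‖cexp (I * x) - 1 - I * x‖ ≤ 3 * x ^ 2 := by
  have hn : ‖I * (x : ℂ)‖ = |x| := by simp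
  rcases le_or_gt |x| 1 with h | h
  · have := norm_exp_sub_one_sub_id_le (x := I * x) (by rwa [hn])
    rw [hn, sq_abs] at this
    nlinarith [sq_nonneg x]
  · have h1 : ‖cexp (I * x) - 1‖ ≤ |x| := Real.norm_exp_I_mul_ofReal_sub_one_le
    have h2 := norm_sub_le (cexp (I * x) - 1) (I * x)
    rw [hn] at h2
    nlinarith [sq_abs x]

open Complex in
lemma tendsto_cexp_I_mul_sub_one_div (x : ℝ) :
    Tendsto (fun l : ℝ => (cexp (I * (l * x : ℝ)) - 1) / l) (𝓝[≠] 0) (𝓝 (I * x)) := by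
  rw [tendsto_iff_norm_sub_tendsto_zero]
  have hb : Tendsto (fun l : ℝ => 3 * x ^ 2 * |l|) (𝓝[≠] 0) (𝓝 0) := by
    have : Tendsto (fun l : ℝ => 3 * x ^ 2 * |l|) (𝓝 0) (𝓝 (3 * x ^ 2 * |0|)) :=
      (continuous_const.mul continuous_abs).tendsto _
    simp only [abs_zero, mul_zero] at this
    exact this.mono_left nhdsWithin_le_nhds
  refine squeeze_zero' (.of_forall fun _ => norm_nonneg _) ?_ hb
  filter_upwards [self_mem_nhdsWithin] with l hl
  have hl0 : l ≠ 0 := hl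
  have hl' : (l : ℂ) ≠ 0 := by exact_mod_cast hl0
  have e : (cexp (I * (l * x : ℝ)) - 1) / l - I * x =
      (cexp (I * (l * x : ℝ)) - 1 - I * (l * x : ℝ)) / l := by
    push_cast
    field_simp
  rw [e, norm_div, norm_real, Real.norm_eq_abs, div_le_iff₀ (abs_pos.2 hl0)]
  refine (norm_cexp_I_mul_sub_one_sub_le _).trans (le_of_eq ?_)
  rw [mul_assoc, ← sq, sq_abs]
  ring

open Complex in
lemma tendsto_cexp_I_mul_sub_one_sub_div_sq (x : ℝ) :
    Tendsto (fun l : ℝ => (cexp (I * (l * x : ℝ)) - 1 - I * (l * x : ℝ)) / (l : ℂ) ^ 2)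
      (𝓝[≠] 0) (𝓝 ((-(x ^ 2 / 2) : ℝ) : ℂ)) := by
  rw [tendsto_iff_norm_sub_tendsto_zero]
  have hb : Tendsto (fun l : ℝ => |l| * |x| ^ 3 * Real.exp (|l| * |x|)) (𝓝[≠] 0) (𝓝 0) := by
    have : Tendsto (fun l : ℝ => |l| * |x| ^ 3 * Real.exp (|l| * |x|)) (𝓝 0)
        (𝓝 (|0| * |x| ^ 3 * Real.exp (|0| * |x|))) := by
      apply Continuous.tendsto (f := fun l : ℝ => |l| * |x| ^ 3 * Real.exp (|l| * |x|))
      fun_prop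
    simp only [abs_zero, zero_mul] at this
    exact this.mono_left nhdsWithin_le_nhds
  refine squeeze_zero' (.of_forall fun _ => norm_nonneg _) ?_ hb
  filter_upwards [self_mem_nhdsWithin] with l hl
  have hl0 : l ≠ 0 := hl
  have hl' : (l : ℂ) ≠ 0 := by exact_mod_cast hl0
  have hI : I * I = -1 := I_mul_I
  have e : (cexp (I * (l * x : ℝ)) - 1 - I * (l * x : ℝ)) / (l : ℂ) ^ 2
      - ((-(x ^ 2 / 2) : ℝ) : ℂ) =
      (cexp (I * (l * x : ℝ)) - ∑ k ∈ Finset.range 3, (I * (l * x : ℝ)) ^ k / (k.factorial : ℂ))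
        / (l : ℂ) ^ 2 := by
    simp only [Finset.sum_range_succ, Finset.sum_range_zero, Nat.factorial]
    push_cast
    field_simp
    rw [I_sq]
    ring
  rw [e, norm_div, norm_pow, norm_real, Real.norm_eq_abs,
    div_le_iff₀ (pow_pos (abs_pos.2 hl0) 2)]
  refine (norm_exp_sub_sum_le_norm_mul_exp _ 3).trans (le_of_eq ?_)
  have hn : ‖I * ((l * x : ℝ) : ℂ)‖ = |l| * |x| := by
    rw [norm_mul, norm_I, norm_real, one_mul, Real.norm_eq_abs, abs_mul]
  rw [hn]
  ring

open Complex in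
/-- `(1 + z n) ^ (m n) → exp w` as soon as `m n * z n → w` and `m n → ∞`. -/
lemma tendsto_one_add_pow_of_tendsto_mul {m : ℕ → ℕ} {z : ℕ → ℂ} {w : ℂ}
    (hm : Tendsto m atTop atTop) (hz : Tendsto (fun n => (m n : ℂ) * z n) atTop (𝓝 w)) :
    Tendsto (fun n => (1 + z n) ^ m n) atTop (𝓝 (cexp w)) := by
  have hm' : Tendsto (fun n => ((m n : ℂ))⁻¹) atTop (𝓝 0) :=
    (tendsto_inv_atTop_nhds_zero_nat (𝕜 := ℂ)).comp hm
  have hz0 : Tendsto z atTop (𝓝 0) := by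
    have := hm'.mul hz
    rw [zero_mul] at this
    refine this.congr' ?_
    filter_upwards [hm.eventually_ne_atTop 0] with n hn
    have : (m n : ℂ) ≠ 0 := by exact_mod_cast hn
    field_simp
  -- `log (1 + z) - z = O(z²)`, and `m z² = (m z) z → 0`.
  have hlog : Tendsto (fun n => (m n : ℂ) * log (1 + z n)) atTop (𝓝 w) := by
    have hO : (fun n => (m n : ℂ) * (log (1 + z n) - z n)) =O[atTop]
        fun n => (m n : ℂ) * z n ^ 2 :=
      (isBigO_refl _ _).mul (log_sub_self_isBigO.comp_tendsto hz0)
    have h0 : Tendsto (fun n => (m n : ℂ) * z n ^ 2) atTop (𝓝 0) := by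
      have := hz.mul hz0
      rw [mul_zero] at this
      refine this.congr fun n => by ring
    have := (hO.trans_tendsto h0).add hz
    rw [zero_add] at this
    exact this.congr fun n => by ring
  refine ((continuous_exp.tendsto _).comp hlog).congr' ?_
  filter_upwards [hz0.eventually_ne (show (0 : ℂ) ≠ -1 by simp)] with n hn
  have hne : 1 + z n ≠ 0 := fun h => hn (by linear_combination h)
  rw [Function.comp_apply, exp_nat_mul, exp_log hne]

variable {Ω : Type*} [MeasurableSpace Ω] {P₀ : Measure Ω}

open Complex in
lemma norm_cexp_I_mul_sub_one_le_two (x : ℝ) : ‖cexp (I * x) - 1‖ ≤ 2 := by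
  refine (norm_sub_le _ _).trans ?_
  rw [norm_exp_I_mul_ofReal]
  norm_num

open Complex in
lemma measurable_cexp_I_mul {κ : Ω → ℝ} (hκ : Measurable κ) (l : ℝ) :
    Measurable fun ω => cexp (I * (l * κ ω : ℝ)) := by
  fun_prop

-- Centering of `κ` removes the first-order term; the second-order one passes to the limit by
-- domination.
open Complex in
lemma tendsto_integral_cexp_sub_one_div_sq [IsProbabilityMeasure P₀] {κ : Ω → ℝ} (hκm : Measurable κ) (hκ : MemLp κ 2 P₀)
    (hκ0 : ∫ ω, κ ω ∂P₀ = 0) :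
    Tendsto (fun l : ℝ => (∫ ω, (cexp (I * (l * κ ω : ℝ)) - 1) ∂P₀) / (l : ℂ) ^ 2) (𝓝[≠] 0)
      (𝓝 ((-(∫ ω, κ ω ^ 2 ∂P₀) / 2 : ℝ) : ℂ)) := by
  have hlim : Tendsto (fun l : ℝ => ∫ ω, (cexp (I * (l * κ ω : ℝ)) - 1 - I * (l * κ ω : ℝ)) /
      (l : ℂ) ^ 2 ∂P₀) (𝓝[≠] 0) (𝓝 (∫ ω, ((-(κ ω ^ 2 / 2) : ℝ) : ℂ) ∂P₀)) := by
    refine tendsto_integral_filter_of_dominated_convergence (fun ω => 3 * κ ω ^ 2) ?_ ?_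
      (hκ.integrable_sq.const_mul 3) ?_
    · exact .of_forall fun l => by
        have := measurable_cexp_I_mul hκm l
        exact Measurable.aestronglyMeasurable (by fun_prop)
    · filter_upwards [self_mem_nhdsWithin] with l hl
      have hl0 : l ≠ 0 := hl
      refine ae_of_all _ fun ω => ?_
      rw [norm_div, norm_pow, norm_real, Real.norm_eq_abs, sq_abs,
        div_le_iff₀ (by positivity)]
      refine (norm_cexp_I_mul_sub_one_sub_le _).trans (le_of_eq (by ring))
    · exact ae_of_all _ fun ω => tendsto_cexp_I_mul_sub_one_sub_div_sq _
  have hval : ∫ ω, ((-(κ ω ^ 2 / 2) : ℝ) : ℂ) ∂P₀ = ((-(∫ ω, κ ω ^ 2 ∂P₀) / 2 : ℝ) : ℂ) := by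
    rw [integral_complex_ofReal, integral_neg, integral_div, neg_div]
  rw [hval] at hlim
  refine hlim.congr fun l => ?_
  have hi : Integrable (fun ω => I * (l * κ ω : ℝ)) P₀ :=
    (((hκ.integrable (by norm_num)).const_mul l).ofReal).const_mul I
  have hi' : Integrable (fun ω => cexp (I * (l * κ ω : ℝ)) - 1) P₀ :=
    Integrable.of_bound ((measurable_cexp_I_mul hκm l).sub_const 1).aestronglyMeasurable 2
      (ae_of_all _ fun ω => norm_cexp_I_mul_sub_one_le_two _)
  rw [integral_div, integral_sub hi' hi, integral_const_mul, integral_complex_ofReal, integral_const_mul,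
    hκ0]
  simp

open Complex in
lemma tendsto_integral_mul_cexp_sub_one_div {κ g : Ω → ℝ} (hκm : Measurable κ)
    (hκ : MemLp κ 2 P₀) (hg : MemLp g 2 P₀) :
    Tendsto (fun l : ℝ => (∫ ω, (g ω : ℂ) * (cexp (I * (l * κ ω : ℝ)) - 1) ∂P₀) / l) (𝓝[≠] 0)
      (𝓝 (I * (∫ ω, κ ω * g ω ∂P₀ : ℝ))) := by
  have hlim : Tendsto (fun l : ℝ => ∫ ω, (g ω : ℂ) * ((cexp (I * (l * κ ω : ℝ)) - 1) / l) ∂P₀)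
      (𝓝[≠] 0) (𝓝 (∫ ω, (g ω : ℂ) * (I * κ ω) ∂P₀)) := by
    refine tendsto_integral_filter_of_dominated_convergence (fun ω => |g ω * κ ω|) ?_ ?_
      (hg.integrable_mul hκ).abs ?_
    · refine .of_forall fun l => ?_
      have := measurable_cexp_I_mul hκm l
      exact (continuous_ofReal.comp_aestronglyMeasurable hg.1).mul
        (Measurable.aestronglyMeasurable (by fun_prop))
    · filter_upwards [self_mem_nhdsWithin] with l hl
      have hl0 : l ≠ 0 := hl
      refine ae_of_all _ fun ω => ?_
      rw [norm_mul, norm_div, norm_real, norm_real, Real.norm_eq_abs, Real.norm_eq_abs, abs_mul]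
      refine mul_le_mul_of_nonneg_left ?_ (abs_nonneg _)
      rw [div_le_iff₀ (abs_pos.2 hl0)]
      refine Real.norm_exp_I_mul_ofReal_sub_one_le.trans (le_of_eq ?_)
      rw [Real.norm_eq_abs, abs_mul, mul_comm]
    · exact ae_of_all _ fun ω => (tendsto_cexp_I_mul_sub_one_div _).const_mul _
  have hval : ∫ ω, (g ω : ℂ) * (I * κ ω) ∂P₀ = I * (∫ ω, κ ω * g ω ∂P₀ : ℝ) := by
    rw [← integral_complex_ofReal, ← integral_const_mul]
    refine integral_congr_ae (ae_of_all _ fun ω => ?_)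
    simp only [ofReal_mul]
    ring
  rw [hval] at hlim
  refine hlim.congr fun l => ?_
  rw [← integral_div]
  refine integral_congr_ae (ae_of_all _ fun ω => ?_)
  simp only [mul_div_assoc]

-- There is no rate, since `g² κ` need not be integrable. Mere convergence suffices, because the
-- factor `m t²` in front stays bounded.
open Complex in
lemma tendsto_integral_sq_mul_norm_cexp_sub_one {κ g : Ω → ℝ} (hκm : Measurable κ)
    (hg : MemLp g 2 P₀) :
    Tendsto (fun l : ℝ => ∫ ω, g ω ^ 2 * ‖cexp (I * (l * κ ω : ℝ)) - 1‖ ∂P₀) (𝓝 0) (𝓝 0) := by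
  have hlim : Tendsto (fun l : ℝ => ∫ ω, g ω ^ 2 * ‖cexp (I * (l * κ ω : ℝ)) - 1‖ ∂P₀)
      (𝓝 0) (𝓝 (∫ ω, (0 : ℝ) ∂P₀)) := by
    refine tendsto_integral_filter_of_dominated_convergence (fun ω => g ω ^ 2 * 2) ?_ ?_
      (hg.integrable_sq.mul_const 2) ?_
    · refine .of_forall fun l => ?_
      have := measurable_cexp_I_mul hκm l
      exact (hg.1.pow 2).mul (Measurable.aestronglyMeasurable (by fun_prop))
    · refine .of_forall fun l => ae_of_all _ fun ω => ?_
      rw [Real.norm_of_nonneg (by positivity)]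
      exact mul_le_mul_of_nonneg_left (norm_cexp_I_mul_sub_one_le_two _) (sq_nonneg _)
    · refine ae_of_all _ fun ω => ?_
      have hc : Continuous fun l : ℝ => g ω ^ 2 * ‖cexp (I * (l * κ ω : ℝ)) - 1‖ := by fun_prop
      simpa using hc.tendsto 0
  simpa using hlim

variable [IsProbabilityMeasure P₀] {P : ℝ → Measure Ω} [∀ t, IsProbabilityMeasure (P t)] {g κ : Ω → ℝ}

open Complex in
lemma norm_integral_score_remainder_mul_le (P : Measure Ω) [IsProbabilityMeasure P]
    (hg : MemLp g 2 P₀) (hκ : MemLp κ 2 P₀) (t l : ℝ) :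
    ‖∫ ω, ((2 * (rootDensity P P₀ ω - 1) - t * g ω : ℝ) : ℂ) *
        (cexp (I * (l * κ ω : ℝ)) - 1) ∂P₀‖ ≤
      √(∫ ω, (2 * (rootDensity P P₀ ω - 1) - t * g ω) ^ 2 ∂P₀) *
        (|l| * √(∫ ω, κ ω ^ 2 ∂P₀)) := by
  have hρ := memLp_score_remainder P P₀ hg t
  have hlκ : MemLp (fun ω => l * κ ω) 2 P₀ := hκ.const_mul l
  have h1 := integral_abs_mul_le hρ hlκ
  have h2 : √(∫ ω, (l * κ ω) ^ 2 ∂P₀) = |l| * √(∫ ω, κ ω ^ 2 ∂P₀) := by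
    simp_rw [mul_pow, integral_const_mul]
    rw [Real.sqrt_mul (sq_nonneg l), Real.sqrt_sq_eq_abs]
  rw [h2] at h1
  refine (norm_integral_le_of_norm_le (hρ.integrable_mul hlκ).abs (ae_of_all _ fun ω => ?_)).trans h1
  rw [norm_mul, norm_real, Real.norm_eq_abs, Pi.mul_apply, abs_mul]
  exact mul_le_mul_of_nonneg_left Real.norm_exp_I_mul_ofReal_sub_one_le (abs_nonneg _)

open Complex in
lemma norm_integral_sq_sub_one_mul_le (P : Measure Ω) [IsProbabilityMeasure P]
    (hg : MemLp g 2 P₀) (hκm : Measurable κ) (t l : ℝ) :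
    ‖∫ ω, (((rootDensity P P₀ ω - 1) ^ 2 : ℝ) : ℂ) * (cexp (I * (l * κ ω : ℝ)) - 1) ∂P₀‖ ≤
      ∫ ω, (2 * (rootDensity P P₀ ω - 1) - t * g ω) ^ 2 ∂P₀ +
        t ^ 2 * ∫ ω, g ω ^ 2 * ‖cexp (I * (l * κ ω : ℝ)) - 1‖ ∂P₀ := by
  have hρ := (memLp_score_remainder P P₀ hg t).integrable_sq
  have hm := measurable_cexp_I_mul hκm l
  have hi : Integrable (fun ω => g ω ^ 2 * ‖cexp (I * (l * κ ω : ℝ)) - 1‖) P₀ := by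
    refine (hg.integrable_sq.mul_const 2).mono
      ((hg.1.pow 2).mul (Measurable.aestronglyMeasurable (by fun_prop))) (ae_of_all _ fun ω => ?_)
    rw [Real.norm_of_nonneg (by positivity), Real.norm_of_nonneg (by positivity)]
    exact mul_le_mul_of_nonneg_left (norm_cexp_I_mul_sub_one_le_two _) (sq_nonneg _)
  rw [← integral_const_mul, ← integral_add hρ (hi.const_mul _)]
  refine norm_integral_le_of_norm_le (hρ.add (hi.const_mul _)) (ae_of_all _ fun ω => ?_)
  rw [norm_mul, norm_real, Real.norm_of_nonneg (sq_nonneg _)]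
  have h2 := norm_cexp_I_mul_sub_one_le_two (l * κ ω)
  have h0 := norm_nonneg (cexp (I * (l * κ ω : ℝ)) - 1)
  set e := ‖cexp (I * (l * κ ω : ℝ)) - 1‖
  set a := rootDensity P P₀ ω - 1
  set b := t * g ω with hb
  -- From `2a = (2a - b) + b`. The first part absorbs `e ≤ 2`; the second keeps the factor `e`,
  -- which makes it small as `l → 0`.
  have h3 : a ^ 2 ≤ (2 * a - b) ^ 2 / 2 + b ^ 2 := by nlinarith [sq_nonneg (2 * a - 2 * b), sq_nonneg b]
  have h4 : t ^ 2 * (g ω ^ 2 * e) = b ^ 2 * e := by rw [hb]; ring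
  rw [h4]
  nlinarith [mul_le_mul_of_nonneg_right h3 h0, mul_le_mul_of_nonneg_left h2 (sq_nonneg (2 * a - b))]

-- Write `e = 1 + (e - 1)` and expand `ρ² = 1 + 2(ρ - 1) + (ρ - 1)²` in front of `e - 1`, splitting
-- `2(ρ - 1)` into `t g` and the remainder.
open Complex in
lemma integral_rootDensity_sq_mul_eq (P : Measure Ω) [IsProbabilityMeasure P]
    (hg : MemLp g 2 P₀) (hκm : Measurable κ) (t l : ℝ) :
    ∫ ω, (rootDensity P P₀ ω ^ 2 : ℝ) * cexp (I * (l * κ ω : ℝ)) ∂P₀ =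
      (∫ ω, rootDensity P P₀ ω ^ 2 ∂P₀ : ℝ) +
      ((∫ ω, (cexp (I * (l * κ ω : ℝ)) - 1) ∂P₀) +
      (t * (∫ ω, (g ω : ℂ) * (cexp (I * (l * κ ω : ℝ)) - 1) ∂P₀) +
      ((∫ ω, ((2 * (rootDensity P P₀ ω - 1) - t * g ω : ℝ) : ℂ) *
        (cexp (I * (l * κ ω : ℝ)) - 1) ∂P₀) +
      ∫ ω, (((rootDensity P P₀ ω - 1) ^ 2 : ℝ) : ℂ) * (cexp (I * (l * κ ω : ℝ)) - 1) ∂P₀))) := by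
  have hm : AEStronglyMeasurable (fun ω => cexp (I * (l * κ ω : ℝ)) - 1) P₀ :=
    ((measurable_cexp_I_mul hκm l).sub_const 1).aestronglyMeasurable
  have hbd : ∀ᵐ ω ∂P₀, ‖cexp (I * (l * κ ω : ℝ)) - 1‖ ≤ 2 :=
    ae_of_all _ fun ω => norm_cexp_I_mul_sub_one_le_two _
  have hmul : ∀ f : Ω → ℝ, Integrable f P₀ →
      Integrable (fun ω => (f ω : ℂ) * (cexp (I * (l * κ ω : ℝ)) - 1)) P₀ :=
    fun f hf => hf.ofReal.mul_bdd hm hbd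
  have i1 := (integrable_rootDensity_sq P P₀).ofReal (𝕜 := ℂ)
  have i2 : Integrable (fun ω => cexp (I * (l * κ ω : ℝ)) - 1) P₀ := Integrable.of_bound hm 2 hbd
  have i3 := (hmul g (hg.integrable (by norm_num))).const_mul (t : ℂ)
  have i4 := hmul _ ((memLp_score_remainder P P₀ hg t).integrable (by norm_num))
  have i5 := hmul _ (memLp_rootDensity_sub_one P P₀).integrable_sq
  rw [← integral_const_mul, ← integral_complex_ofReal, ← integral_add i4 i5,
    ← integral_add i3 (by exact i4.add i5), ← integral_add i2 (by exact i3.add (i4.add i5)),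
    ← integral_add (by exact i1) (by exact i2.add (i3.add (i4.add i5)))]
  refine integral_congr_ae (ae_of_all _ fun ω => ?_)
  push_cast
  ring

open Complex in
/-- Local expansion of characteristic functions along a curve with score `g`: the `m n`-fold
product converges to the characteristic function of a shifted normal law. -/
lemma HasScore.tendsto_pow_integral_cexp (h : HasScore P P₀ g) (hκm : Measurable κ)
    (hκ : MemLp κ 2 P₀) (hκ0 : ∫ ω, κ ω ∂P₀ = 0) {t l : ℕ → ℝ} {m : ℕ → ℕ} {A B C : ℝ}
    (ht : Tendsto t atTop (𝓝[≠] 0)) (hl : Tendsto l atTop (𝓝[≠] 0)) (hm : Tendsto m atTop atTop)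
    (hA : Tendsto (fun n => (m n : ℝ) * (l n * t n)) atTop (𝓝 A))
    (hB : Tendsto (fun n => (m n : ℝ) * l n ^ 2) atTop (𝓝 B))
    (hC : Tendsto (fun n => (m n : ℝ) * t n ^ 2) atTop (𝓝 C)) :
    Tendsto (fun n => (∫ ω, cexp (I * (l n * κ ω : ℝ)) ∂(P (t n))) ^ m n) atTop
      (𝓝 (cexp (I * (A * ∫ ω, κ ω * g ω ∂P₀ : ℝ) - (B / 2 * ∫ ω, κ ω ^ 2 ∂P₀ : ℝ)))) := by
  have hl0 : ∀ᶠ n in atTop, l n ≠ 0 := hl.eventually self_mem_nhdsWithin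
  have ht0 : ∀ᶠ n in atTop, t n ≠ 0 := ht.eventually self_mem_nhdsWithin
  have scale : ∀ f : ℝ → ℝ, f =o[𝓝[≠] 0] (fun t : ℝ => t ^ 2) →
      Tendsto (fun n => (m n : ℝ) * f (t n)) atTop (𝓝 0) := by
    intro f hf
    have := hC.mul (hf.tendsto_div_nhds_zero.comp ht)
    rw [mul_zero] at this
    refine this.congr' ?_
    filter_upwards [ht0] with n hn
    simp only [Function.comp_apply]
    field_simp
  have hS := scale _ h.singular
  have hR := scale _ h.remainder
  -- `L0` and `L1` account for the singular part, `L2` yields the variance, `L3` the mean shift;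
  -- `L4` and `L5` are negligible.
  have L0 : Tendsto (fun n => (m n : ℂ) * (∫ ω, cexp (I * (l n * κ ω : ℝ)) ∂(P (t n)) -
      ∫ ω, (rootDensity (P (t n)) P₀ ω ^ 2 : ℝ) * cexp (I * (l n * κ ω : ℝ)) ∂P₀))
      atTop (𝓝 0) := by
    refine squeeze_zero_norm (fun n => ?_) hS
    rw [norm_mul, Complex.norm_natCast]
    refine mul_le_mul_of_nonneg_left ?_ (Nat.cast_nonneg _)
    exact norm_integral_sub_integral_rootDensity_sq_le _ _ (measurable_cexp_I_mul hκm _)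
      fun ω => (norm_exp_I_mul_ofReal _).le
  have L1 : Tendsto (fun n => (m n : ℂ) * ((∫ ω, rootDensity (P (t n)) P₀ ω ^ 2 ∂P₀ : ℝ) - 1))
      atTop (𝓝 0) := by
    have := (hS.neg).ofReal
    rw [neg_zero] at this
    refine this.congr fun n => ?_
    push_cast
    ring
  have L2 : Tendsto (fun n => (m n : ℂ) * ∫ ω, (cexp (I * (l n * κ ω : ℝ)) - 1) ∂P₀) atTop
      (𝓝 (-(B / 2 * ∫ ω, κ ω ^ 2 ∂P₀ : ℝ))) := by
    have := (hB.ofReal).mul ((tendsto_integral_cexp_sub_one_div_sq hκm hκ hκ0).comp hl)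
    have e : ((B : ℝ) : ℂ) * ((-(∫ ω, κ ω ^ 2 ∂P₀) / 2 : ℝ) : ℂ) =
        -(B / 2 * ∫ ω, κ ω ^ 2 ∂P₀ : ℝ) := by push_cast; ring
    rw [e] at this
    refine this.congr' ?_
    filter_upwards [hl0] with n hn
    have hn' : (l n : ℂ) ≠ 0 := by exact_mod_cast hn
    simp only [Function.comp_apply]
    push_cast
    field_simp
  have L3 : Tendsto (fun n => (m n : ℂ) * (t n * ∫ ω, (g ω : ℂ) *
      (cexp (I * (l n * κ ω : ℝ)) - 1) ∂P₀)) atTop (𝓝 (I * (A * ∫ ω, κ ω * g ω ∂P₀ : ℝ))) := by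
    have := (hA.ofReal).mul
      ((tendsto_integral_mul_cexp_sub_one_div hκm hκ h.memLp).comp hl)
    have e : ((A : ℝ) : ℂ) * (I * ((∫ ω, κ ω * g ω ∂P₀ : ℝ) : ℂ)) =
        I * (A * ∫ ω, κ ω * g ω ∂P₀ : ℝ) := by push_cast; ring
    rw [e] at this
    refine this.congr' ?_
    filter_upwards [hl0] with n hn
    have hn' : (l n : ℂ) ≠ 0 := by exact_mod_cast hn
    simp only [Function.comp_apply]
    push_cast
    field_simp
  have L4 : Tendsto (fun n => (m n : ℂ) * ∫ ω, ((2 * (rootDensity (P (t n)) P₀ ω - 1) -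
      t n * g ω : ℝ) : ℂ) * (cexp (I * (l n * κ ω : ℝ)) - 1) ∂P₀) atTop (𝓝 0) := by
    -- `m √R |l| = √(m R) √(m l²)`, where `m R → 0` and `m l²` converges.
    have hb := ((hR.sqrt).mul (hB.sqrt)).mul_const (√(∫ ω, κ ω ^ 2 ∂P₀))
    rw [Real.sqrt_zero, zero_mul, zero_mul] at hb
    refine squeeze_zero_norm (fun n => ?_) hb
    rw [norm_mul, Complex.norm_natCast]
    refine (mul_le_mul_of_nonneg_left (norm_integral_score_remainder_mul_le (P (t n)) h.memLp hκ
      (t n) (l n)) (Nat.cast_nonneg _)).trans (le_of_eq ?_)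
    have hm0 : (0 : ℝ) ≤ m n := Nat.cast_nonneg _
    rw [Real.sqrt_mul hm0, Real.sqrt_mul hm0, Real.sqrt_sq_eq_abs]
    nth_rewrite 1 [← Real.mul_self_sqrt hm0]
    ring
  have L5 : Tendsto (fun n => (m n : ℂ) * ∫ ω, (((rootDensity (P (t n)) P₀ ω - 1) ^ 2 : ℝ) : ℂ) *
      (cexp (I * (l n * κ ω : ℝ)) - 1) ∂P₀) atTop (𝓝 0) := by
    have hl' : Tendsto l atTop (𝓝 0) := hl.mono_right nhdsWithin_le_nhds
    have hb := hR.add (hC.mul ((tendsto_integral_sq_mul_norm_cexp_sub_one hκm h.memLp).comp hl'))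
    rw [mul_zero, zero_add] at hb
    refine squeeze_zero_norm (fun n => ?_) hb
    rw [norm_mul, Complex.norm_natCast]
    refine (mul_le_mul_of_nonneg_left (norm_integral_sq_sub_one_mul_le (P (t n)) h.memLp hκm
      (t n) (l n)) (Nat.cast_nonneg _)).trans (le_of_eq ?_)
    rw [Function.comp_apply]
    ring
  have L := L0.add (L1.add (L2.add (L3.add (L4.add L5))))
  have key := tendsto_one_add_pow_of_tendsto_mul (z := fun n =>
    ∫ ω, cexp (I * (l n * κ ω : ℝ)) ∂(P (t n)) - 1)
    (w := I * (A * ∫ ω, κ ω * g ω ∂P₀ : ℝ) - (B / 2 * ∫ ω, κ ω ^ 2 ∂P₀ : ℝ)) hm ?_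
  · simpa using key
  · refine (L.congr fun n => ?_).trans (le_of_eq ?_)
    · rw [integral_rootDensity_sq_mul_eq (P (t n)) h.memLp hκm (t n) (l n)]
      ring
    · congr 1
      ring

end CharFunExpansion

/-! ### Additivity of elements of the tangent space. -/

section Components

variable {Ω₁ Ω₂ : Type*} [MeasurableSpace Ω₁] [MeasurableSpace Ω₂]
  {Pfam : Set (ProbabilityMeasure Ω₁)} {Qfam : Set (ProbabilityMeasure Ω₂)}
  {P₀ : ProbabilityMeasure Ω₁} {Q₀ : ProbabilityMeasure Ω₂} {f g : Ω₁ × Ω₂ → ℝ}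

/-- The part of `f` orthogonal to all sums of a function of the first and a function of the second
coordinate, for centered `f`. -/
def interaction (P₀ : ProbabilityMeasure Ω₁) (Q₀ : ProbabilityMeasure Ω₂) (f : Ω₁ × Ω₂ → ℝ)
    (z : Ω₁ × Ω₂) : ℝ :=
  f z - firstComponent Q₀ f z.1 - secondComponent P₀ f z.2

lemma memLp_firstComponent (hf : MemLp f 2 ((P₀ : Measure Ω₁).prod (Q₀ : Measure Ω₂))) :
    MemLp (firstComponent Q₀ f) 2 (P₀ : Measure Ω₁) :=
  memLp_two_integral_prod_right hf

lemma memLp_secondComponent (hf : MemLp f 2 ((P₀ : Measure Ω₁).prod (Q₀ : Measure Ω₂))) :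
    MemLp (secondComponent P₀ f) 2 (Q₀ : Measure Ω₂) :=
  memLp_two_integral_prod_right (hf.comp_measurePreserving Measure.measurePreserving_swap)

lemma measurable_firstComponent (hf : Measurable f) : Measurable (firstComponent Q₀ f) :=
  (hf.stronglyMeasurable.integral_prod_right' (ν := (Q₀ : Measure Ω₂))).measurable

lemma measurable_secondComponent (hf : Measurable f) : Measurable (secondComponent P₀ f) :=
  (hf.stronglyMeasurable.integral_prod_left' (μ := (P₀ : Measure Ω₁))).measurable

lemma integral_firstComponent (hf : MemLp f 2 ((P₀ : Measure Ω₁).prod (Q₀ : Measure Ω₂))) :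
    ∫ x, firstComponent Q₀ f x ∂(P₀ : Measure Ω₁) =
      ∫ z, f z ∂((P₀ : Measure Ω₁).prod (Q₀ : Measure Ω₂)) :=
  (integral_prod _ (hf.integrable (by norm_num))).symm

lemma integral_secondComponent (hf : MemLp f 2 ((P₀ : Measure Ω₁).prod (Q₀ : Measure Ω₂))) :
    ∫ y, secondComponent P₀ f y ∂(Q₀ : Measure Ω₂) =
      ∫ z, f z ∂((P₀ : Measure Ω₁).prod (Q₀ : Measure Ω₂)) :=
  (integral_prod_symm _ (hf.integrable (by norm_num))).symm

lemma memLp_interaction (hf : MemLp f 2 ((P₀ : Measure Ω₁).prod (Q₀ : Measure Ω₂))) :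
    MemLp (interaction P₀ Q₀ f) 2 ((P₀ : Measure Ω₁).prod (Q₀ : Measure Ω₂)) :=
  (hf.sub (memLp_comp_fst (memLp_firstComponent hf))).sub
    (memLp_comp_snd (memLp_secondComponent hf))

lemma integral_interaction_right (hf : MemLp f 2 ((P₀ : Measure Ω₁).prod (Q₀ : Measure Ω₂)))
    (hf0 : ∫ z, f z ∂((P₀ : Measure Ω₁).prod (Q₀ : Measure Ω₂)) = 0) :
    ∀ᵐ x ∂(P₀ : Measure Ω₁), ∫ y, interaction P₀ Q₀ f (x, y) ∂(Q₀ : Measure Ω₂) = 0 := by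
  filter_upwards [ae_memLp_two_prod_right hf] with x hx
  have i1 : Integrable (fun y => f (x, y)) (Q₀ : Measure Ω₂) := hx.integrable (by norm_num)
  have i2 := (memLp_secondComponent hf).integrable (by norm_num)
  simp only [interaction]
  rw [integral_sub (by exact i1.sub (integrable_const _)) i2, integral_sub i1 (integrable_const _),
    integral_secondComponent hf, hf0]
  simp [firstComponent]

lemma integral_interaction_left (hf : MemLp f 2 ((P₀ : Measure Ω₁).prod (Q₀ : Measure Ω₂)))
    (hf0 : ∫ z, f z ∂((P₀ : Measure Ω₁).prod (Q₀ : Measure Ω₂)) = 0) :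
    ∀ᵐ y ∂(Q₀ : Measure Ω₂), ∫ x, interaction P₀ Q₀ f (x, y) ∂(P₀ : Measure Ω₁) = 0 := by
  filter_upwards [ae_memLp_two_prod_right
    (hf.comp_measurePreserving Measure.measurePreserving_swap)] with y hy
  have i1 : Integrable (fun x => f (x, y)) (P₀ : Measure Ω₁) := hy.integrable (by norm_num)
  have i2 := (memLp_firstComponent hf).integrable (by norm_num)
  simp only [interaction]
  rw [integral_sub (by exact i1.sub i2) (integrable_const _), integral_sub i1 i2,
    integral_firstComponent hf, hf0]
  simp [secondComponent]

/-- A function orthogonal to both coordinates is orthogonal to the tangents of product curves. -/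
lemma integral_interaction_mul_tangent
    (hf : MemLp f 2 ((P₀ : Measure Ω₁).prod (Q₀ : Measure Ω₂)))
    (hf0 : ∫ z, f z ∂((P₀ : Measure Ω₁).prod (Q₀ : Measure Ω₂)) = 0)
    {γ : ℝ → ProbabilityMeasure (Ω₁ × Ω₂)} (hγ0 : γ 0 = P₀.prod Q₀)
    (hγ : IsL2DiffCurve (prodFamily Pfam Qfam) γ g) :
    ∫ z, interaction P₀ Q₀ f z * g z ∂((P₀ : Measure Ω₁).prod (Q₀ : Measure Ω₂)) = 0 := by
  have hs := hγ.hasScore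
  rw [hγ0] at hs
  -- Near `0` the curve consists of product measures, so its factors are its marginals. Using
  -- marginals keeps the factors probability measures for every `t`, also outside that interval.
  have hprod : (fun t => (γ t : Measure (Ω₁ × Ω₂))) =ᶠ[𝓝[≠] 0] fun t =>
      ((γ t : Measure (Ω₁ × Ω₂)).map Prod.fst).prod ((γ t : Measure (Ω₁ × Ω₂)).map Prod.snd) := by
    obtain ⟨ε, hε, hmem⟩ := hγ.mem_family
    have hnear : ∀ᶠ t : ℝ in 𝓝[≠] 0, |t| < ε := by
      refine nhdsWithin_le_nhds ?_
      filter_upwards [Metric.ball_mem_nhds (0 : ℝ) hε] with t ht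
      simpa using ht
    filter_upwards [hnear] with t ht
    obtain ⟨P, -, Q, -, hPQ⟩ := hmem t ht
    rw [hPQ, ProbabilityMeasure.toMeasure_prod, Measure.map_fst_prod, Measure.map_snd_prod]
    simp
  have hp1 : ∀ t, IsProbabilityMeasure ((γ t : Measure (Ω₁ × Ω₂)).map Prod.fst) :=
    fun t => Measure.isProbabilityMeasure_map measurable_fst.aemeasurable
  have hp2 : ∀ t, IsProbabilityMeasure ((γ t : Measure (Ω₁ × Ω₂)).map Prod.snd) :=
    fun t => Measure.isProbabilityMeasure_map measurable_snd.aemeasurable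
  exact (hs.congr hprod).integral_mul_eq_zero (memLp_interaction hf)
    (integral_interaction_right hf hf0) (integral_interaction_left hf hf0)

/-- The orthogonal complement of the interaction is a closed subspace containing every tangent,
hence the whole tangent space, and `f` in particular. -/
lemma integral_interaction_mul_of_mem_tangentSpace
    (hf : MemLp f 2 ((P₀.prod Q₀ : ProbabilityMeasure (Ω₁ × Ω₂)) : Measure (Ω₁ × Ω₂)))
    (hf0 : ∫ z, f z ∂((P₀.prod Q₀ : ProbabilityMeasure (Ω₁ × Ω₂)) : Measure (Ω₁ × Ω₂)) = 0)
    (hmem : hf.toLp f ∈ familyTangentSpace (prodFamily Pfam Qfam) (P₀.prod Q₀)) :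
    ∫ z, interaction P₀ Q₀ f z * f z ∂((P₀ : Measure Ω₁).prod (Q₀ : Measure Ω₂)) = 0 := by
  have hr : MemLp (interaction P₀ Q₀ f) 2
      ((P₀.prod Q₀ : ProbabilityMeasure (Ω₁ × Ω₂)) : Measure (Ω₁ × Ω₂)) := memLp_interaction hf
  have hinner : ∀ h : Lp ℝ 2 ((P₀.prod Q₀ : ProbabilityMeasure (Ω₁ × Ω₂)) : Measure (Ω₁ × Ω₂)),
      inner ℝ (hr.toLp _) h = ∫ z, interaction P₀ Q₀ f z * h z
        ∂((P₀.prod Q₀ : ProbabilityMeasure (Ω₁ × Ω₂)) : Measure (Ω₁ × Ω₂)) := by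
    intro h
    rw [L2.inner_def]
    refine integral_congr_ae ?_
    filter_upwards [hr.coeFn_toLp] with z hz
    rw [hz]
    simp [mul_comm]
  have hle : familyTangentSpace (prodFamily Pfam Qfam) (P₀.prod Q₀) ≤
      (Submodule.span ℝ {hr.toLp _})ᗮ := by
    refine Submodule.topologicalClosure_minimal _ (Submodule.span_le.2 ?_)
      (Submodule.isClosed_orthogonal _)
    rintro h ⟨-, γ, hγ0, hγ⟩
    rw [SetLike.mem_coe, Submodule.mem_orthogonal_singleton_iff_inner_right, hinner]
    exact integral_interaction_mul_tangent hf hf0 hγ0 hγ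
  have h1 := hle hmem
  rw [Submodule.mem_orthogonal_singleton_iff_inner_right, hinner] at h1
  rw [← h1]
  refine integral_congr_ae ?_
  filter_upwards [hf.coeFn_toLp] with z hz
  rw [hz]

/-- Elements of the tangent space of a family of product measures are sums of their components. -/
lemma ae_eq_components_of_mem_tangentSpace
    (hf : MemLp f 2 ((P₀.prod Q₀ : ProbabilityMeasure (Ω₁ × Ω₂)) : Measure (Ω₁ × Ω₂)))
    (hf0 : ∫ z, f z ∂((P₀.prod Q₀ : ProbabilityMeasure (Ω₁ × Ω₂)) : Measure (Ω₁ × Ω₂)) = 0)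
    (hmem : hf.toLp f ∈ familyTangentSpace (prodFamily Pfam Qfam) (P₀.prod Q₀)) :
    ∀ᵐ z ∂((P₀ : Measure Ω₁).prod (Q₀ : Measure Ω₂)),
      f z = firstComponent Q₀ f z.1 + secondComponent P₀ f z.2 := by
  have hf' : MemLp f 2 ((P₀ : Measure Ω₁).prod (Q₀ : Measure Ω₂)) := hf
  have hr := memLp_interaction hf'
  have h1 := memLp_firstComponent hf'
  have h2 := memLp_secondComponent hf'
  have e0 := integral_interaction_mul_of_mem_tangentSpace hf hf0 hmem
  have e1 : ∫ z, firstComponent Q₀ f z.1 * interaction P₀ Q₀ f z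
      ∂((P₀ : Measure Ω₁).prod (Q₀ : Measure Ω₂)) = 0 := by
    rw [integral_fst_mul h1 hr]
    refine integral_eq_zero_of_ae ?_
    filter_upwards [integral_interaction_right hf' hf0] with x hx
    simp [hx]
  have e2 : ∫ z, secondComponent P₀ f z.2 * interaction P₀ Q₀ f z
      ∂((P₀ : Measure Ω₁).prod (Q₀ : Measure Ω₂)) = 0 := by
    rw [integral_snd_mul h2 hr]
    refine integral_eq_zero_of_ae ?_
    filter_upwards [integral_interaction_left hf' hf0] with x hx
    simp [hx]
  have i0 := hr.integrable_mul hf'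
  have i1 := (memLp_comp_fst (ν := (Q₀ : Measure Ω₂)) h1).integrable_mul hr
  have i2 := (memLp_comp_snd (μ := (P₀ : Measure Ω₁)) h2).integrable_mul hr
  -- The interaction is `f - f₁ - f₂` and is orthogonal to each of the three, so its norm vanishes.
  have hsq : ∫ z, interaction P₀ Q₀ f z ^ 2 ∂((P₀ : Measure Ω₁).prod (Q₀ : Measure Ω₂)) = 0 := by
    have e : ∀ z, interaction P₀ Q₀ f z ^ 2 = interaction P₀ Q₀ f z * f z -
        firstComponent Q₀ f z.1 * interaction P₀ Q₀ f z -
        secondComponent P₀ f z.2 * interaction P₀ Q₀ f z := fun z => by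
      simp only [interaction]; ring
    simp_rw [e]
    rw [integral_sub (by exact i0.sub i1) (by exact i2), integral_sub (by exact i0) (by exact i1),
      e0, e1, e2]
    simp
  rw [integral_eq_zero_iff_of_nonneg (fun _ => sq_nonneg _) hr.integrable_sq] at hsq
  filter_upwards [hsq] with z hz
  have : interaction P₀ Q₀ f z = 0 := by simpa using hz
  simp only [interaction] at this
  linarith

/-- Only `f` has to be additive: integrating out the other variable turns `g` into its components.
It serves for the mean shift and, with `g = f`, for positivity of the variance. -/
lemma integral_mul_eq_of_ae_eq_components
    (hf : MemLp f 2 ((P₀ : Measure Ω₁).prod (Q₀ : Measure Ω₂)))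
    (hg : MemLp g 2 ((P₀ : Measure Ω₁).prod (Q₀ : Measure Ω₂)))
    (hadd : ∀ᵐ z ∂((P₀ : Measure Ω₁).prod (Q₀ : Measure Ω₂)),
      f z = firstComponent Q₀ f z.1 + secondComponent P₀ f z.2) :
    ∫ z, f z * g z ∂((P₀ : Measure Ω₁).prod (Q₀ : Measure Ω₂)) =
      ∫ x, firstComponent Q₀ f x * firstComponent Q₀ g x ∂(P₀ : Measure Ω₁) +
      ∫ y, secondComponent P₀ f y * secondComponent P₀ g y ∂(Q₀ : Measure Ω₂) := by
  have h1 := memLp_firstComponent hf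
  have h2 := memLp_secondComponent hf
  have i1 := (memLp_comp_fst (ν := (Q₀ : Measure Ω₂)) h1).integrable_mul hg
  have i2 := (memLp_comp_snd (μ := (P₀ : Measure Ω₁)) h2).integrable_mul hg
  have e1 := integral_fst_mul h1 hg
  have e2 := integral_snd_mul h2 hg
  unfold firstComponent secondComponent at *
  rw [← e1, ← e2, ← integral_add (by exact i1) (by exact i2)]
  refine integral_congr_ae ?_
  filter_upwards [hadd] with z hz
  nth_rewrite 1 [hz]
  ring

end Components

/-! ### The two-sample law: factorization and null sets. -/

section SampleLaw

variable {Ω₁ Ω₂ : Type*} [MeasurableSpace Ω₁] [MeasurableSpace Ω₂]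

instance isProbabilityMeasure_sampleLaw (P : ProbabilityMeasure Ω₁) (Q : ProbabilityMeasure Ω₂)
    (n₁ n₂ : ℕ) : IsProbabilityMeasure (sampleLaw P Q n₁ n₂) := by
  unfold sampleLaw
  infer_instance

open Complex in
lemma integral_cexp_sum_sampleLaw (P : ProbabilityMeasure Ω₁) (Q : ProbabilityMeasure Ω₂)
    (n₁ n₂ : ℕ) (f : Ω₁ → ℝ) (h : Ω₂ → ℝ) :
    ∫ x, cexp (I * (∑ i, f (x.1 i) + ∑ j, h (x.2 j) : ℝ)) ∂(sampleLaw P Q n₁ n₂) =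
      (∫ ω, cexp (I * (f ω : ℝ)) ∂(P : Measure Ω₁)) ^ n₁ *
      (∫ ω, cexp (I * (h ω : ℝ)) ∂(Q : Measure Ω₂)) ^ n₂ := by
  have e : ∀ x : (Fin n₁ → Ω₁) × (Fin n₂ → Ω₂),
      cexp (I * (∑ i, f (x.1 i) + ∑ j, h (x.2 j) : ℝ)) =
        (∏ i, cexp (I * f (x.1 i))) * ∏ j, cexp (I * h (x.2 j)) := by
    intro x
    rw [← Complex.exp_sum, ← Complex.exp_sum, ← Complex.exp_add, ← Finset.mul_sum,
      ← Finset.mul_sum]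
    push_cast
    ring_nf
  simp_rw [e, sampleLaw]
  rw [integral_prod_mul (fun x : Fin n₁ → Ω₁ => ∏ i, cexp (I * f (x i)))
    (fun y : Fin n₂ → Ω₂ => ∏ j, cexp (I * h (y j))),
    integral_fintype_prod_eq_prod (𝕜 := ℂ) (fun _ ω => cexp (I * f ω)),
    integral_fintype_prod_eq_prod (𝕜 := ℂ) (fun _ ω => cexp (I * h ω))]
  simp

/-- A `P₀`-null carrier of the singular part: the absolutely continuous part gives it no mass, so
its `P`-mass is exactly the singular mass. -/
lemma exists_measurableSet_restrict_compl_absolutelyContinuous {Ω : Type*} [MeasurableSpace Ω]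
    (P P₀ : Measure Ω) [IsProbabilityMeasure P] [IsProbabilityMeasure P₀] :
    ∃ s, MeasurableSet s ∧ P.real s = 1 - ∫ ω, rootDensity P P₀ ω ^ 2 ∂P₀ ∧
      P.restrict sᶜ ≪ P₀ := by
  obtain ⟨s, hs, h1, h2⟩ := P.mutuallySingular_singularPart P₀
  have hdec := P.singularPart_add_rnDeriv P₀
  refine ⟨sᶜ, hs.compl, ?_, ?_⟩
  · rw [integral_rootDensity_sq, sub_sub_cancel]
    have hac : P₀.withDensity (P.rnDeriv P₀) sᶜ = 0 := withDensity_absolutelyContinuous _ _ h2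
    have : P sᶜ = P.singularPart P₀ Set.univ := by
      conv_lhs => rw [← hdec]
      rw [Measure.add_apply, hac, add_zero, ← measure_add_measure_compl hs, h1, zero_add]
    simp only [Measure.real, this]
  · rw [compl_compl]
    conv_lhs => rw [← hdec]
    rw [Measure.restrict_add, Measure.restrict_eq_zero.2 h1, zero_add]
    exact Measure.absolutelyContinuous_of_le Measure.restrict_le_self |>.trans
      (withDensity_absolutelyContinuous _ _)

/-- A null set of `P₀ ⊗ Q₀` is hit by some pair of the two samples only with a probability that is
controlled by the masses of the singular parts. -/
lemma measureReal_sampleLaw_exists_mem_le (P P₀ : ProbabilityMeasure Ω₁)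
    (Q Q₀ : ProbabilityMeasure Ω₂) (n₁ n₂ : ℕ) {N : Set (Ω₁ × Ω₂)}
    (hN : ((P₀ : Measure Ω₁).prod (Q₀ : Measure Ω₂)) N = 0) :
    (sampleLaw P Q n₁ n₂).real {x | ∃ i j, (x.1 i, x.2 j) ∈ N} ≤
      n₁ * (1 - ∫ ω, rootDensity (P : Measure Ω₁) P₀ ω ^ 2 ∂(P₀ : Measure Ω₁)) +
      n₂ * (1 - ∫ ω, rootDensity (Q : Measure Ω₂) Q₀ ω ^ 2 ∂(Q₀ : Measure Ω₂)) := by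
  obtain ⟨s, hs, hsP, hsac⟩ :=
    exists_measurableSet_restrict_compl_absolutelyContinuous (P : Measure Ω₁) (P₀ : Measure Ω₁)
  obtain ⟨u, hu, huQ, huac⟩ :=
    exists_measurableSet_restrict_compl_absolutelyContinuous (Q : Measure Ω₂) (Q₀ : Measure Ω₂)
  have hnull : ((P : Measure Ω₁).prod (Q : Measure Ω₂)) (N ∩ sᶜ ×ˢ uᶜ) = 0 := by
    have := (hsac.prod huac) hN
    rwa [Measure.prod_restrict, Measure.restrict_apply₀' (hs.compl.prod hu.compl).nullMeasurableSet]
      at this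
  have hfst : ∀ i : Fin n₁, MeasurePreserving (fun x : (Fin n₁ → Ω₁) × (Fin n₂ → Ω₂) => x.1 i)
      (sampleLaw P Q n₁ n₂) (P : Measure Ω₁) := fun i =>
    (measurePreserving_eval (fun _ : Fin n₁ => (P : Measure Ω₁)) i).comp measurePreserving_fst
  have hsnd : ∀ j : Fin n₂, MeasurePreserving (fun x : (Fin n₁ → Ω₁) × (Fin n₂ → Ω₂) => x.2 j)
      (sampleLaw P Q n₁ n₂) (Q : Measure Ω₂) := fun j =>
    (measurePreserving_eval (fun _ : Fin n₂ => (Q : Measure Ω₂)) j).comp measurePreserving_snd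
  have hpair : ∀ (i : Fin n₁) (j : Fin n₂), MeasurePreserving
      (fun x : (Fin n₁ → Ω₁) × (Fin n₂ → Ω₂) => (x.1 i, x.2 j))
      (sampleLaw P Q n₁ n₂) ((P : Measure Ω₁).prod (Q : Measure Ω₂)) := fun i j =>
    (measurePreserving_eval (fun _ : Fin n₁ => (P : Measure Ω₁)) i).prod
      (measurePreserving_eval (fun _ : Fin n₂ => (Q : Measure Ω₂)) j)
  -- Singular hits are counted per observation, not per pair, so the bound grows like `n₁ + n₂` and
  -- not `n₁ n₂`. The pairs avoiding `s` and `u` contribute a null event.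
  have hsub : {x : (Fin n₁ → Ω₁) × (Fin n₂ → Ω₂) | ∃ i j, (x.1 i, x.2 j) ∈ N} ⊆
      ((⋃ i, (fun x => x.1 i) ⁻¹' s) ∪ ⋃ j, (fun x => x.2 j) ⁻¹' u) ∪
        ⋃ i, ⋃ j, (fun x => (x.1 i, x.2 j)) ⁻¹' (N ∩ sᶜ ×ˢ uᶜ) := by
    rintro x ⟨i, j, hij⟩
    by_cases h1 : x.1 i ∈ s
    · exact Or.inl (Or.inl (Set.mem_iUnion.2 ⟨i, h1⟩))
    by_cases h2 : x.2 j ∈ u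
    · exact Or.inl (Or.inr (Set.mem_iUnion.2 ⟨j, h2⟩))
    · exact Or.inr (Set.mem_iUnion₂.2 ⟨i, j, hij, h1, h2⟩)
  have hnull' : (sampleLaw P Q n₁ n₂).real (⋃ i, ⋃ j,
      (fun x : (Fin n₁ → Ω₁) × (Fin n₂ → Ω₂) => (x.1 i, x.2 j)) ⁻¹' (N ∩ sᶜ ×ˢ uᶜ)) = 0 := by
    rw [measureReal_eq_zero_iff, measure_iUnion_null_iff]
    intro i
    rw [measure_iUnion_null_iff]
    exact fun j => (hpair i j).quasiMeasurePreserving.preimage_null hnull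
  have hs' : (sampleLaw P Q n₁ n₂).real (⋃ i : Fin n₁,
      (fun x : (Fin n₁ → Ω₁) × (Fin n₂ → Ω₂) => x.1 i) ⁻¹' s) ≤ n₁ * (P : Measure Ω₁).real s := by
    refine (measureReal_iUnion_fintype_le _).trans (le_of_eq ?_)
    simp [fun i => (hfst i).measureReal_preimage hs.nullMeasurableSet]
  have hu' : (sampleLaw P Q n₁ n₂).real (⋃ j : Fin n₂,
      (fun x : (Fin n₁ → Ω₁) × (Fin n₂ → Ω₂) => x.2 j) ⁻¹' u) ≤ n₂ * (Q : Measure Ω₂).real u := by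
    refine (measureReal_iUnion_fintype_le _).trans (le_of_eq ?_)
    simp [fun i => (hsnd i).measureReal_preimage hu.nullMeasurableSet]
  rw [← hsP, ← huQ]
  refine (measureReal_mono hsub).trans ((measureReal_union_le _ _).trans ?_)
  rw [hnull', add_zero]
  exact (measureReal_union_le _ _).trans (add_le_add hs' hu')

lemma norm_integral_sub_le_two_mul_measureReal {Ω : Type*} [MeasurableSpace Ω] {μ : Measure Ω}
    [IsProbabilityMeasure μ] {F G : Ω → ℂ} (hF : Measurable F) (hG : Measurable G)
    (hF1 : ∀ ω, ‖F ω‖ ≤ 1) (hG1 : ∀ ω, ‖G ω‖ ≤ 1) {s : Set Ω} (hs : MeasurableSet s)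
    (h : ∀ ω, ω ∉ s → F ω = G ω) : ‖∫ ω, F ω ∂μ - ∫ ω, G ω ∂μ‖ ≤ 2 * μ.real s := by
  rw [← integral_sub (Integrable.of_bound hF.aestronglyMeasurable 1 (ae_of_all _ hF1))
    (Integrable.of_bound hG.aestronglyMeasurable 1 (ae_of_all _ hG1))]
  have hi : Integrable (s.indicator fun _ => (2 : ℝ)) μ := (integrable_const _).indicator hs
  refine (norm_integral_le_of_norm_le hi (ae_of_all _ fun ω => ?_)).trans (le_of_eq ?_)
  · by_cases hω : ω ∈ s
    · rw [Set.indicator_of_mem hω]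
      refine (norm_sub_le _ _).trans ?_
      linarith [hF1 ω, hG1 ω]
    · rw [Set.indicator_of_notMem hω, h ω hω]
      simp
  · rw [integral_indicator_const _ hs, smul_eq_mul, mul_comm]

end SampleLaw

/-! ### Normal quantiles and tail probabilities. -/

section Normal

lemma cdf_stdNormalQuantile {p : ℝ} (hp : p ∈ Set.Ioo (0 : ℝ) 1) :
    cdf (gaussianReal 0 1) (stdNormalQuantile p) = p := by
  set F := cdf (gaussianReal 0 1)
  have hcont : Continuous F := by
    have : NullSingletonClass (gaussianReal 0 1) := nullSingletonClass_gaussianReal one_ne_zero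
    refine continuous_iff_continuousAt.2 fun x => ?_
    refine continuousAt_iff_continuous_left_right.2 ⟨?_, F.right_continuous x⟩
    rw [← continuousWithinAt_Iio_iff_Iic, F.mono.continuousWithinAt_Iio_iff_leftLim_eq]
    have h0 : F.measure {x} = 0 := by
      rw [measure_cdf]
      exact measure_singleton x
    rw [F.measure_singleton, ENNReal.ofReal_eq_zero] at h0
    exact le_antisymm (F.mono.leftLim_le le_rfl) (by linarith)
  have hne : {x : ℝ | p ≤ F x}.Nonempty :=
    ((tendsto_cdf_atTop _).eventually (lt_mem_nhds hp.2)).exists.imp fun _ h => h.le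
  obtain ⟨b, hb⟩ := ((tendsto_cdf_atBot (gaussianReal 0 1)).eventually (gt_mem_nhds hp.1)).exists
  have hbdd : BddBelow {x : ℝ | p ≤ F x} :=
    ⟨b, fun x hx => le_of_not_gt fun h => absurd (hx.trans ((monotone_cdf _) h.le)) (not_le.2 hb)⟩
  have hclosed : IsClosed {x : ℝ | p ≤ F x} := isClosed_le continuous_const hcont
  have hmem : p ≤ F (stdNormalQuantile p) := hclosed.csInf_mem hne hbdd
  refine le_antisymm ?_ hmem
  -- Left of the infimum the distribution function is below `p`; continuity carries this to the
  -- infimum.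
  refine le_of_tendsto (hcont.continuousAt.tendsto.mono_left nhdsWithin_le_nhds :
    Tendsto F (𝓝[<] (stdNormalQuantile p)) _) ?_
  filter_upwards [self_mem_nhdsWithin] with x hx
  exact le_of_not_ge fun h => absurd (csInf_le hbdd h) (not_le.2 hx)

/-- Standardization moves the threshold `u` by `-m / √v`, so the sign of `m` decides the comparison
with the centered case. -/
lemma gaussianReal_real_Ioi_mul_sqrt (m : ℝ) {v : ℝ} (hv : 0 < v) (u : ℝ) :
    (gaussianReal m v.toNNReal).real (Set.Ioi (u * √v)) =
      1 - cdf (gaussianReal 0 1) (u - m / √v) := by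
  have hs : 0 < √v := Real.sqrt_pos.2 hv
  have hmap : (gaussianReal 0 1).map (fun x => √v * x + m) = gaussianReal m v.toNNReal := by
    have h1 := gaussianReal_map_const_mul (μ := 0) (v := 1) (√v)
    have h2 := gaussianReal_map_add_const (μ := √v * 0)
      (v := .mk ((√v) ^ 2) (sq_nonneg _) * 1) m
    rw [← h1, Measure.map_map (by fun_prop) (by fun_prop)] at h2
    rw [mul_zero, zero_add, mul_one] at h2
    have hvar : NNReal.mk ((√v) ^ 2) (sq_nonneg _) = v.toNNReal :=
      NNReal.eq (by rw [Real.coe_toNNReal _ hv.le]; exact Real.sq_sqrt hv.le)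
    rw [hvar] at h2
    exact h2
  rw [← hmap, map_measureReal_apply (by fun_prop) measurableSet_Ioi, cdf_eq_real,
    ← probReal_compl_eq_one_sub measurableSet_Iic]
  congr 1
  ext x
  simp only [Set.mem_preimage, Set.mem_Ioi, Set.mem_compl_iff, Set.mem_Iic, not_le]
  have e : √v * x + m - u * √v = √v * (x - (u - m / √v)) := by
    field_simp
    ring
  rw [← sub_pos, e, mul_pos_iff_of_pos_left hs, sub_pos]

lemma gaussianReal_real_Ioi_quantile_le {m v α : ℝ} (hv : 0 < v) (hα : α ∈ Set.Ioo (0 : ℝ) 1)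
    (hm : m ≤ 0) :
    (gaussianReal m v.toNNReal).real (Set.Ioi (stdNormalQuantile (1 - α) * √v)) ≤ α := by
  have h := cdf_stdNormalQuantile (p := 1 - α) ⟨by linarith [hα.2], by linarith [hα.1]⟩
  rw [gaussianReal_real_Ioi_mul_sqrt m hv]
  have := monotone_cdf (gaussianReal 0 1) (show stdNormalQuantile (1 - α) ≤
    stdNormalQuantile (1 - α) - m / √v by
      linarith [div_nonpos_of_nonpos_of_nonneg hm (Real.sqrt_nonneg v)])
  linarith

lemma le_gaussianReal_real_Ioi_quantile {m v α : ℝ} (hv : 0 < v) (hα : α ∈ Set.Ioo (0 : ℝ) 1)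
    (hm : 0 ≤ m) :
    α ≤ (gaussianReal m v.toNNReal).real (Set.Ioi (stdNormalQuantile (1 - α) * √v)) := by
  have h := cdf_stdNormalQuantile (p := 1 - α) ⟨by linarith [hα.2], by linarith [hα.1]⟩
  rw [gaussianReal_real_Ioi_mul_sqrt m hv]
  have := monotone_cdf (gaussianReal 0 1) (show stdNormalQuantile (1 - α) - m / √v ≤
    stdNormalQuantile (1 - α) by linarith [div_nonneg hm (Real.sqrt_nonneg v)])
  linarith

end Normal

/-! ### Limit law of the test statistic along local sequences. -/

section LocalAsymptotics

/-- The linear statistic that the test statistic reduces to when its kernel is the sum of its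
components. -/
lemma twoSampleTestStat_eq_of_eq_add {Ω₁ Ω₂ : Type*} {f : Ω₁ × Ω₂ → ℝ} {f₁ : Ω₁ → ℝ} {f₂ : Ω₂ → ℝ} {n₁ n₂ : ℕ} (h₁ : n₁ ≠ 0)
    (h₂ : n₂ ≠ 0) (x : (Fin n₁ → Ω₁) × (Fin n₂ → Ω₂))
    (h : ∀ i j, f (x.1 i, x.2 j) = f₁ (x.1 i) + f₂ (x.2 j)) :
    twoSampleTestStat f n₁ n₂ x =
      ∑ i, √((n₁ + n₂ : ℕ) : ℝ) / n₁ * f₁ (x.1 i) +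
      ∑ j, √((n₁ + n₂ : ℕ) : ℝ) / n₂ * f₂ (x.2 j) := by
  have h₁' : (n₁ : ℝ) ≠ 0 := by exact_mod_cast h₁
  have h₂' : (n₂ : ℝ) ≠ 0 := by exact_mod_cast h₂
  simp only [twoSampleTestStat, twoSampleUStat, h, Finset.sum_add_distrib, Finset.sum_const,
    Finset.card_univ, Fintype.card_fin, ← Finset.mul_sum, nsmul_eq_mul]
  field_simp

variable {Ω₁ Ω₂ : Type*} [MeasurableSpace Ω₁] [MeasurableSpace Ω₂] {f g : Ω₁ × Ω₂ → ℝ}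

lemma measurable_twoSampleTestStat (hf : Measurable f) (n₁ n₂ : ℕ) :
    Measurable (twoSampleTestStat f n₁ n₂) := by
  unfold twoSampleTestStat twoSampleUStat
  fun_prop

lemma oneSidedTest_eq_indicator (P : ProbabilityMeasure Ω₁) (Q : ProbabilityMeasure Ω₂)
    (d α : ℝ) (n₁ n₂ : ℕ) : oneSidedTest P Q f d α n₁ n₂ =
      (twoSampleTestStat f n₁ n₂ ⁻¹' Set.Ioi (criticalValue P Q f d α)).indicator 1 := by
  ext x
  by_cases h : criticalValue P Q f d α < twoSampleTestStat f n₁ n₂ x <;>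
    simp [oneSidedTest, h]

lemma integral_oneSidedTest (hf : Measurable f) (P : ProbabilityMeasure Ω₁)
    (Q : ProbabilityMeasure Ω₂) (d α : ℝ) (n₁ n₂ : ℕ)
    (μ : Measure ((Fin n₁ → Ω₁) × (Fin n₂ → Ω₂))) :
    ∫ x, oneSidedTest P Q f d α n₁ n₂ x ∂μ =
      (μ.map (twoSampleTestStat f n₁ n₂)).real (Set.Ioi (criticalValue P Q f d α)) := by
  rw [oneSidedTest_eq_indicator, integral_indicator_one
    (measurable_twoSampleTestStat hf n₁ n₂ measurableSet_Ioi),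
    map_measureReal_apply (measurable_twoSampleTestStat hf n₁ n₂) measurableSet_Ioi]

-- The statistic is linear unless some pair of observations hits the null set where additivity
-- fails; there, two integrands of modulus one differ by at most `2`.
open Complex in
lemma norm_charFun_testStat_sub_le (P P₀ : ProbabilityMeasure Ω₁) (Q Q₀ : ProbabilityMeasure Ω₂)
    (hf : Measurable f) {f₁ : Ω₁ → ℝ} {f₂ : Ω₂ → ℝ} (hf₁ : Measurable f₁) (hf₂ : Measurable f₂)
    (hadd : ∀ᵐ z ∂((P₀ : Measure Ω₁).prod (Q₀ : Measure Ω₂)), f z = f₁ z.1 + f₂ z.2)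
    {n₁ n₂ : ℕ} (h₁ : n₁ ≠ 0) (h₂ : n₂ ≠ 0) (s : ℝ) :
    ‖charFun ((sampleLaw P Q n₁ n₂).map (twoSampleTestStat f n₁ n₂)) s -
      (∫ ω, cexp (I * (s * √((n₁ + n₂ : ℕ) : ℝ) / n₁ * f₁ ω : ℝ)) ∂(P : Measure Ω₁)) ^ n₁ *
      (∫ ω, cexp (I * (s * √((n₁ + n₂ : ℕ) : ℝ) / n₂ * f₂ ω : ℝ)) ∂(Q : Measure Ω₂)) ^ n₂‖ ≤
      2 * (n₁ * (1 - ∫ ω, rootDensity (P : Measure Ω₁) P₀ ω ^ 2 ∂(P₀ : Measure Ω₁)) +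
      n₂ * (1 - ∫ ω, rootDensity (Q : Measure Ω₂) Q₀ ω ^ 2 ∂(Q₀ : Measure Ω₂))) := by
  have hT := measurable_twoSampleTestStat hf n₁ n₂
  set N : Set (Ω₁ × Ω₂) := {z | f z ≠ f₁ z.1 + f₂ z.2} with hNdef
  have hN : MeasurableSet N :=
    (measurableSet_eq_fun hf ((hf₁.comp measurable_fst).add (hf₂.comp measurable_snd))).compl
  have hS : MeasurableSet {x : (Fin n₁ → Ω₁) × (Fin n₂ → Ω₂) | ∃ i j, (x.1 i, x.2 j) ∈ N} := by
    have : {x : (Fin n₁ → Ω₁) × (Fin n₂ → Ω₂) | ∃ i j, (x.1 i, x.2 j) ∈ N} =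
        ⋃ i, ⋃ j, (fun x => (x.1 i, x.2 j)) ⁻¹' N := by ext; simp
    rw [this]
    exact .iUnion fun i => .iUnion fun j => hN.preimage (by fun_prop)
  rw [charFun_apply_real, integral_map hT.aemeasurable
    (Measurable.aestronglyMeasurable (by fun_prop)), ← integral_cexp_sum_sampleLaw P Q n₁ n₂
      (fun ω => s * √((n₁ + n₂ : ℕ) : ℝ) / n₁ * f₁ ω)
      (fun ω => s * √((n₁ + n₂ : ℕ) : ℝ) / n₂ * f₂ ω)]
  refine (norm_integral_sub_le_two_mul_measureReal (by fun_prop) (by fun_prop) (fun x => ?_)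
    (fun x => (norm_exp_I_mul_ofReal _).le) hS fun x hx => ?_).trans
    (mul_le_mul_of_nonneg_left (measureReal_sampleLaw_exists_mem_le P P₀ Q Q₀ n₁ n₂ hadd)
      zero_le_two)
  · rw [← ofReal_mul, mul_comm, norm_exp_I_mul_ofReal]
  · have hx' : ∀ i j, f (x.1 i, x.2 j) = f₁ (x.1 i) + f₂ (x.2 j) := by
      intro i j
      by_contra hne
      exact hx ⟨i, j, hne⟩
    rw [twoSampleTestStat_eq_of_eq_add h₁ h₂ x hx', ← ofReal_mul, mul_comm _ I, mul_add,
      Finset.mul_sum, Finset.mul_sum]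
    simp only [mul_div_assoc, mul_assoc]

variable {n₁ n₂ : ℕ → ℕ} {d : ℝ}

lemma tendsto_fst_size_div (hn : ∀ n, n₁ n + n₂ n = n)
    (hnd : Tendsto (fun n : ℕ => (n₂ n : ℝ) / n) atTop (𝓝 d)) :
    Tendsto (fun n : ℕ => (n₁ n : ℝ) / n) atTop (𝓝 (1 - d)) := by
  refine (hnd.const_sub 1).congr' ?_
  filter_upwards [eventually_ne_atTop 0] with n hn0
  have hn' : (n : ℝ) ≠ 0 := by exact_mod_cast hn0
  have h : (n₁ n : ℝ) + n₂ n = n := by exact_mod_cast hn n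
  field_simp
  linarith

lemma tendsto_size_atTop {m : ℕ → ℕ} {c : ℝ} (hc : 0 < c)
    (hm : Tendsto (fun n : ℕ => (m n : ℝ) / n) atTop (𝓝 c)) : Tendsto m atTop atTop := by
  rw [← tendsto_natCast_atTop_iff (R := ℝ)]
  refine (hm.pos_mul_atTop hc (tendsto_natCast_atTop_atTop (R := ℝ))).congr' ?_
  filter_upwards [eventually_ne_atTop 0] with n hn0
  have hn' : (n : ℝ) ≠ 0 := by exact_mod_cast hn0
  field_simp

open Complex in
/-- Characteristic functions of a normalized sum over a sample of size `m n ∼ c n` along a local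
sequence. -/
lemma HasScore.tendsto_pow_of_local {Ω : Type*} [MeasurableSpace Ω] {P : ℝ → Measure Ω}
    {P₀ : Measure Ω} [∀ t, IsProbabilityMeasure (P t)] [IsProbabilityMeasure P₀] {g κ : Ω → ℝ}
    (h : HasScore P P₀ g) (hκm : Measurable κ) (hκ : MemLp κ 2 P₀) (hκ0 : ∫ ω, κ ω ∂P₀ = 0)
    {m : ℕ → ℕ} {c : ℝ} (hc : 0 < c) (hm : Tendsto (fun n : ℕ => (m n : ℝ) / n) atTop (𝓝 c))
    {t : ℕ → ℝ} {τ : ℝ} (ht : Tendsto t atTop (𝓝[≠] 0))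
    (hτ : Tendsto (fun n : ℕ => t n * √n) atTop (𝓝 τ)) {s : ℝ} (hs : s ≠ 0) :
    Tendsto (fun n : ℕ => (∫ ω, cexp (I * (s * √(n : ℝ) / m n * κ ω : ℝ)) ∂(P (t n))) ^ m n) atTop
      (𝓝 (cexp (I * (s * τ * ∫ ω, κ ω * g ω ∂P₀ : ℝ) -
        (s ^ 2 / c / 2 * ∫ ω, κ ω ^ 2 ∂P₀ : ℝ)))) := by
  have hmtop := tendsto_size_atTop hc hm
  have hpos : ∀ᶠ n : ℕ in atTop, (0 : ℝ) < n ∧ (0 : ℝ) < m n := by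
    filter_upwards [eventually_gt_atTop 0, hmtop.eventually_gt_atTop 0] with n h1 h2
    exact ⟨by exact_mod_cast h1, by exact_mod_cast h2⟩
  have hB : Tendsto (fun n : ℕ => (m n : ℝ) * (s * √(n : ℝ) / m n) ^ 2) atTop (𝓝 (s ^ 2 / c)) := by
    have := (hm.inv₀ hc.ne').const_mul (s ^ 2)
    rw [← div_eq_mul_inv] at this
    refine this.congr' ?_
    filter_upwards [hpos] with n ⟨h1, h2⟩
    rw [div_pow, mul_pow, Real.sq_sqrt h1.le]
    field_simp
  -- With `l = s√n / m`: `m l t → sτ`, `m l² → s² / c` and `m t² → cτ²`.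
  refine h.tendsto_pow_integral_cexp hκm hκ hκ0 (C := c * τ ^ 2) ht ?_ hmtop ?_ hB ?_
  · refine tendsto_nhdsWithin_iff.2 ⟨?_, ?_⟩
    · have h0 : Tendsto (fun n : ℕ => (m n : ℝ)⁻¹) atTop (𝓝 0) :=
        tendsto_inv_atTop_zero.comp ((tendsto_natCast_atTop_atTop (R := ℝ)).comp hmtop)
      -- `l² = (m l²) / m` tends to zero, hence so does `l`.
      have hsq : Tendsto (fun n : ℕ => (s * √(n : ℝ) / m n) ^ 2) atTop (𝓝 0) := by
        have := h0.mul hB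
        rw [zero_mul] at this
        refine this.congr' ?_
        filter_upwards [hpos] with n ⟨h1, h2⟩
        field_simp
      simpa [Real.sqrt_sq_eq_abs, tendsto_zero_iff_abs_tendsto_zero, Function.comp_def]
        using hsq.sqrt
    · filter_upwards [hpos] with n ⟨h1, h2⟩
      have := Real.sqrt_pos.2 h1
      exact div_ne_zero (mul_ne_zero hs this.ne') h2.ne'
  · refine (hτ.const_mul s).congr' ?_
    filter_upwards [hpos] with n ⟨h1, h2⟩
    field_simp
  · refine (hm.mul (hτ.pow 2)).congr' ?_
    filter_upwards [hpos] with n ⟨h1, h2⟩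
    rw [mul_pow, Real.sq_sqrt h1.le]
    field_simp

lemma IsLocalSeq.tendsto_nhdsGT {t : ℕ → ℝ} (h : IsLocalSeq t) : Tendsto t atTop (𝓝[>] 0) := by
  obtain ⟨h0, τ, hτ0, hτ⟩ := h
  refine tendsto_nhdsWithin_iff.2 ⟨h0, ?_⟩
  filter_upwards [hτ.eventually (lt_mem_nhds hτ0)] with n hn
  exact pos_of_mul_pos_left hn (Real.sqrt_nonneg _)

lemma HasScore.tendsto_mul_one_sub {Ω : Type*} [MeasurableSpace Ω] {P : ℝ → Measure Ω}
    {P₀ : Measure Ω} {g : Ω → ℝ} (h : HasScore P P₀ g)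
    {m : ℕ → ℕ} {c : ℝ} (hm : Tendsto (fun n : ℕ => (m n : ℝ) / n) atTop (𝓝 c))
    {t : ℕ → ℝ} {τ : ℝ} (ht : Tendsto t atTop (𝓝[≠] 0))
    (hτ : Tendsto (fun n : ℕ => t n * √n) atTop (𝓝 τ)) :
    Tendsto (fun n => (m n : ℝ) * (1 - ∫ ω, rootDensity (P (t n)) P₀ ω ^ 2 ∂P₀)) atTop (𝓝 0) := by
  have := (hm.mul (hτ.pow 2)).mul (h.singular.tendsto_div_nhds_zero.comp ht)
  rw [mul_zero] at this
  refine this.congr' ?_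
  filter_upwards [eventually_gt_atTop 0, ht.eventually self_mem_nhdsWithin] with n hn htn
  have hn' : (0 : ℝ) < n := by exact_mod_cast hn
  have htn' : t n ≠ 0 := htn
  rw [mul_pow, Real.sq_sqrt hn'.le, Function.comp_apply]
  field_simp

open Complex in
/-- Asymptotic normality of the test statistic along local sequences of product curves. -/
lemma tendsto_map_testStat {P₀ : ProbabilityMeasure Ω₁} {Q₀ : ProbabilityMeasure Ω₂}
    {P : ℝ → ProbabilityMeasure Ω₁} {Q : ℝ → ProbabilityMeasure Ω₂}
    (hscore : HasScore (fun t => (P t : Measure Ω₁).prod (Q t : Measure Ω₂))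
      ((P₀ : Measure Ω₁).prod (Q₀ : Measure Ω₂)) g)
    (hf : Measurable f) (hf2 : MemLp f 2 ((P₀ : Measure Ω₁).prod (Q₀ : Measure Ω₂)))
    (hf0 : ∫ z, f z ∂((P₀ : Measure Ω₁).prod (Q₀ : Measure Ω₂)) = 0)
    (hadd : ∀ᵐ z ∂((P₀ : Measure Ω₁).prod (Q₀ : Measure Ω₂)),
      f z = firstComponent Q₀ f z.1 + secondComponent P₀ f z.2)
    (hn : ∀ n, n₁ n + n₂ n = n) (hd : d ∈ Set.Ioo (0 : ℝ) 1)
    (hnd : Tendsto (fun n : ℕ => (n₂ n : ℝ) / n) atTop (𝓝 d))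
    {t : ℕ → ℝ} {τ : ℝ} (ht : Tendsto t atTop (𝓝[≠] 0))
    (hτ : Tendsto (fun n : ℕ => t n * √n) atTop (𝓝 τ)) (s : ℝ) :
    Tendsto (fun n => charFun ((sampleLaw (P (t n)) (Q (t n)) (n₁ n) (n₂ n)).map
        (twoSampleTestStat f (n₁ n) (n₂ n))) s) atTop
      (𝓝 (charFun (gaussianReal (τ * ∫ z, f z * g z ∂((P₀ : Measure Ω₁).prod (Q₀ : Measure Ω₂)))
        (1 / (1 - d) * ∫ x, firstComponent Q₀ f x ^ 2 ∂(P₀ : Measure Ω₁) +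
          1 / d * ∫ y, secondComponent P₀ f y ^ 2 ∂(Q₀ : Measure Ω₂)).toNNReal) s)) := by
  have hprob : ∀ n, IsProbabilityMeasure ((sampleLaw (P (t n)) (Q (t n)) (n₁ n) (n₂ n)).map
      (twoSampleTestStat f (n₁ n) (n₂ n))) := fun n =>
    Measure.isProbabilityMeasure_map (measurable_twoSampleTestStat hf _ _).aemeasurable
  -- The expansion requires nonzero arguments `l`; at `s = 0` both characteristic functions equal
  -- `1`.
  rcases eq_or_ne s 0 with rfl | hs
  · simp
  have hd1 : 0 < 1 - d := by linarith [hd.2]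
  have hn₁ := tendsto_fst_size_div hn hnd
  have hS1 : HasScore (fun t => (P t : Measure Ω₁)) (P₀ : Measure Ω₁) (firstComponent Q₀ g) :=
    hscore.fst
  have hS2 : HasScore (fun t => (Q t : Measure Ω₂)) (Q₀ : Measure Ω₂) (secondComponent P₀ g) :=
    hscore.snd
  have l1 := hS1.tendsto_pow_of_local (measurable_firstComponent hf) (memLp_firstComponent hf2)
    ((integral_firstComponent hf2).trans hf0) hd1 hn₁ ht hτ hs
  have l2 := hS2.tendsto_pow_of_local (measurable_secondComponent hf) (memLp_secondComponent hf2)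
    ((integral_secondComponent hf2).trans hf0) hd.1 hnd ht hτ hs
  have l3 := ((hS1.tendsto_mul_one_sub hn₁ ht hτ).add
    (hS2.tendsto_mul_one_sub hnd ht hτ)).const_mul 2
  rw [add_zero, mul_zero] at l3
  have hdiff : Tendsto (fun n => charFun ((sampleLaw (P (t n)) (Q (t n)) (n₁ n) (n₂ n)).map
        (twoSampleTestStat f (n₁ n) (n₂ n))) s -
      (∫ ω, cexp (I * (s * √(n : ℝ) / n₁ n * firstComponent Q₀ f ω : ℝ))
        ∂(P (t n) : Measure Ω₁)) ^ n₁ n *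
      (∫ ω, cexp (I * (s * √(n : ℝ) / n₂ n * secondComponent P₀ f ω : ℝ))
        ∂(Q (t n) : Measure Ω₂)) ^ n₂ n) atTop (𝓝 0) := by
    refine squeeze_zero_norm' ?_ l3
    filter_upwards [(tendsto_size_atTop hd1 hn₁).eventually_ne_atTop 0,
      (tendsto_size_atTop hd.1 hnd).eventually_ne_atTop 0] with n h1 h2
    have := norm_charFun_testStat_sub_le (P (t n)) P₀ (Q (t n)) Q₀ hf
      (measurable_firstComponent hf) (measurable_secondComponent hf) hadd h1 h2 s
    rwa [hn n] at this
  have l4 := hdiff.add (l1.mul l2)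
  refine (l4.congr fun n => by ring).trans (le_of_eq ?_)
  congr 1
  have hv : 0 ≤ 1 / (1 - d) * ∫ x, firstComponent Q₀ f x ^ 2 ∂(P₀ : Measure Ω₁) +
      1 / d * ∫ y, secondComponent P₀ f y ^ 2 ∂(Q₀ : Measure Ω₂) :=
    add_nonneg (mul_nonneg (by positivity) (integral_nonneg fun _ => sq_nonneg _))
      (mul_nonneg (by have := hd.1; positivity) (integral_nonneg fun _ => sq_nonneg _))
  rw [charFun_gaussianReal, zero_add, ← Complex.exp_add,
    integral_mul_eq_of_ae_eq_components hf2 hscore.memLp hadd, ← NNReal.coe_toRealHom]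
  congr 1
  simp only [NNReal.coe_toRealHom, Real.coe_toNNReal _ hv]
  push_cast
  ring

/-- The power of the test along a local sequence converges to a normal tail probability. -/
lemma tendsto_integral_oneSidedTest {P₀ : ProbabilityMeasure Ω₁} {Q₀ : ProbabilityMeasure Ω₂}
    {P : ℝ → ProbabilityMeasure Ω₁} {Q : ℝ → ProbabilityMeasure Ω₂}
    (hscore : HasScore (fun t => (P t : Measure Ω₁).prod (Q t : Measure Ω₂))
      ((P₀ : Measure Ω₁).prod (Q₀ : Measure Ω₂)) g)
    (hf : Measurable f) (hf2 : MemLp f 2 ((P₀ : Measure Ω₁).prod (Q₀ : Measure Ω₂)))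
    (hf0 : ∫ z, f z ∂((P₀ : Measure Ω₁).prod (Q₀ : Measure Ω₂)) = 0)
    (hadd : ∀ᵐ z ∂((P₀ : Measure Ω₁).prod (Q₀ : Measure Ω₂)),
      f z = firstComponent Q₀ f z.1 + secondComponent P₀ f z.2)
    (hn : ∀ n, n₁ n + n₂ n = n) (hd : d ∈ Set.Ioo (0 : ℝ) 1)
    (hnd : Tendsto (fun n : ℕ => (n₂ n : ℝ) / n) atTop (𝓝 d)) (α : ℝ)
    (hv : 0 < 1 / (1 - d) * ∫ x, firstComponent Q₀ f x ^ 2 ∂(P₀ : Measure Ω₁) +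
          1 / d * ∫ y, secondComponent P₀ f y ^ 2 ∂(Q₀ : Measure Ω₂))
    {t : ℕ → ℝ} {τ : ℝ} (ht : Tendsto t atTop (𝓝[≠] 0))
    (hτ : Tendsto (fun n : ℕ => t n * √n) atTop (𝓝 τ)) :
    Tendsto (fun n => ∫ x, oneSidedTest P₀ Q₀ f d α (n₁ n) (n₂ n) x
        ∂(sampleLaw (P (t n)) (Q (t n)) (n₁ n) (n₂ n))) atTop
      (𝓝 ((gaussianReal (τ * ∫ z, f z * g z ∂((P₀ : Measure Ω₁).prod (Q₀ : Measure Ω₂)))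
        (1 / (1 - d) * ∫ x, firstComponent Q₀ f x ^ 2 ∂(P₀ : Measure Ω₁) +
          1 / d * ∫ y, secondComponent P₀ f y ^ 2 ∂(Q₀ : Measure Ω₂)).toNNReal).real
          (Set.Ioi (criticalValue P₀ Q₀ f d α)))) := by
  have hprob : ∀ n, IsProbabilityMeasure ((sampleLaw (P (t n)) (Q (t n)) (n₁ n) (n₂ n)).map
      (twoSampleTestStat f (n₁ n) (n₂ n))) := fun n =>
    Measure.isProbabilityMeasure_map (measurable_twoSampleTestStat hf _ _).aemeasurable
  obtain ⟨G, hG⟩ : ∃ G : ProbabilityMeasure ℝ, (G : Measure ℝ) =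
      gaussianReal (τ * ∫ z, f z * g z ∂((P₀ : Measure Ω₁).prod (Q₀ : Measure Ω₂)))
        (1 / (1 - d) * ∫ x, firstComponent Q₀ f x ^ 2 ∂(P₀ : Measure Ω₁) +
          1 / d * ∫ y, secondComponent P₀ f y ^ 2 ∂(Q₀ : Measure Ω₂)).toNNReal :=
    ⟨⟨gaussianReal _ _, inferInstance⟩, rfl⟩
  have hatom := nullSingletonClass_gaussianReal
    (μ := τ * ∫ z, f z * g z ∂((P₀ : Measure Ω₁).prod (Q₀ : Measure Ω₂)))
    (Real.toNNReal_pos.2 hv).ne'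
  have hchar := tendsto_map_testStat hscore hf hf2 hf0 hadd hn hd hnd ht hτ
  rw [← hG] at hatom hchar ⊢
  have hweak := ProbabilityMeasure.tendsto_of_tendsto_charFun (μ := fun n => ⟨_, hprob n⟩)
    (μ₀ := G) hchar
  -- Positive variance makes the limit atomless, so the half-line beyond the critical value has a
  -- null boundary.
  have h := ProbabilityMeasure.tendsto_measure_of_null_frontier_of_tendsto' hweak
    (E := Set.Ioi (criticalValue P₀ Q₀ f d α)) (by rw [frontier_Ioi]; exact measure_singleton _)
  have h' := (ENNReal.tendsto_toReal (measure_ne_top _ _)).comp h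
  refine h'.congr fun n => ?_
  rw [integral_oneSidedTest hf]
  rfl

/-- The increment divided by `n^{-1/2}` is `t√n` times the difference quotient of `k`. The limit is
exactly the mean of the limit law of the test statistic. -/
lemma tendsto_localValue {Pfam : Set (ProbabilityMeasure Ω₁)} {Qfam : Set (ProbabilityMeasure Ω₂)}
    {k : ProbabilityMeasure (Ω₁ × Ω₂) → ℝ} {P : ℝ → ProbabilityMeasure Ω₁}
    {Q : ℝ → ProbabilityMeasure Ω₂}
    (hf : IsGradient (prodFamily Pfam Qfam) k ((P 0).prod (Q 0)) f)
    (hcurve : IsL2DiffCurve (prodFamily Pfam Qfam) (fun t => (P t).prod (Q t)) g)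
    {t : ℕ → ℝ} {τ : ℝ} (ht : Tendsto t atTop (𝓝[>] 0))
    (hτ : Tendsto (fun n : ℕ => t n * √n) atTop (𝓝 τ)) :
    Tendsto (fun n => localValue k P Q n (t n)) atTop
      (𝓝 (τ * ∫ z, f z * g z ∂((P 0 : Measure Ω₁).prod (Q 0 : Measure Ω₂)))) := by
  have h := hτ.mul ((hf.tendsto _ g rfl hcurve).comp ht)
  refine h.congr' ?_
  filter_upwards [ht.eventually self_mem_nhdsWithin] with n htn
  have htn' : t n ≠ 0 := ne_of_gt htn
  rw [localValue, Real.rpow_neg (Nat.cast_nonneg n), ← Real.sqrt_eq_rpow, div_inv_eq_mul,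
    Function.comp_apply]
  field_simp

end LocalAsymptotics

end

/-! ### Asymptotic unbiasedness. -/

theorem mainTheorem12 {Ω₁ Ω₂ : Type*} [MeasurableSpace Ω₁] [MeasurableSpace Ω₂]
    (Pfam : Set (ProbabilityMeasure Ω₁)) (Qfam : Set (ProbabilityMeasure Ω₂))
    -- the statistical functional on `Pfam ⊗ Qfam` and its canonical gradient at `P₀ ⊗ Q₀`
    (k : ProbabilityMeasure (Ω₁ × Ω₂) → ℝ)
    (P₀ : ProbabilityMeasure Ω₁) (Q₀ : ProbabilityMeasure Ω₂)
    (hP₀ : P₀ ∈ Pfam) (hQ₀ : Q₀ ∈ Qfam)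
    (ktil : Ω₁ × Ω₂ → ℝ)
    (hktil : IsCanonicalGradient (prodFamily Pfam Qfam) k (P₀.prod Q₀) ktil)
    (hktil_ne : ∫ ω, ktil ω ^ 2 ∂((P₀.prod Q₀ : ProbabilityMeasure (Ω₁ × Ω₂)) :
      Measure (Ω₁ × Ω₂)) ≠ 0)
    -- sample sizes and level
    (n₁ n₂ : ℕ → ℕ) (hn : ∀ n, n₁ n + n₂ n = n)
    (d : ℝ) (hd : d ∈ Set.Ioo (0 : ℝ) 1)
    (hnd : Tendsto (fun n : ℕ => (n₂ n : ℝ) / n) atTop (𝓝 d))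
    (α : ℝ) (hα : α ∈ Set.Ioo (0 : ℝ) 1)
    -- the curve `t ↦ P_t ⊗ Q_t` of the alternatives, with tangent `g`
    (P : ℝ → ProbabilityMeasure Ω₁) (Q : ℝ → ProbabilityMeasure Ω₂) (g : Ω₁ × Ω₂ → ℝ)
    (hP : P 0 = P₀) (hQ : Q 0 = Q₀)
    (hcurve : IsL2DiffCurve (prodFamily Pfam Qfam) (fun t => (P t).prod (Q t)) g)
    -- the curve `s ↦ P'_s ⊗ Q'_s` of the hypotheses, with tangent `h`
    (P' : ℝ → ProbabilityMeasure Ω₁) (Q' : ℝ → ProbabilityMeasure Ω₂) (h : Ω₁ × Ω₂ → ℝ)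
    (hP' : P' 0 = P₀) (hQ' : Q' 0 = Q₀)
    (hcurve' : IsL2DiffCurve (prodFamily Pfam Qfam) (fun s => (P' s).prod (Q' s)) h)
    -- the local functional limits
    (hpos : ∀ t : ℕ → ℝ, IsLocalSeq t →
      ∃ θ : ℝ, 0 < θ ∧ Tendsto (fun n => localValue k P Q n (t n)) atTop (𝓝 θ))
    (hnonpos : ∀ s : ℕ → ℝ, IsLocalSeq s →
      ∃ θ : ℝ, θ ≤ 0 ∧ Tendsto (fun n => localValue k P' Q' n (s n)) atTop (𝓝 θ)) :
    IsAsymptoticallyUnbiased α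
      (fun n => oneSidedTest P₀ Q₀ ktil d α (n₁ n) (n₂ n))
      (localSequences P' Q' n₁ n₂) (localSequences P Q n₁ n₂) := by
  have hgrad := hktil.isGradient
  have hf2 : MemLp ktil 2 ((P₀ : Measure Ω₁).prod (Q₀ : Measure Ω₂)) := hgrad.memLp
  have hf0 : ∫ z, ktil z ∂((P₀ : Measure Ω₁).prod (Q₀ : Measure Ω₂)) = 0 := hgrad.integral_eq_zero
  have hadd := ae_eq_components_of_mem_tangentSpace hgrad.memLp hf0 hktil.mem_tangentSpace
  have hd1 : 0 < 1 - d := by linarith [hd.2]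
  have hv : 0 < 1 / (1 - d) * ∫ x, firstComponent Q₀ ktil x ^ 2 ∂(P₀ : Measure Ω₁) +
      1 / d * ∫ y, secondComponent P₀ ktil y ^ 2 ∂(Q₀ : Measure Ω₂) := by
    have h1 : 0 ≤ ∫ x, firstComponent Q₀ ktil x ^ 2 ∂(P₀ : Measure Ω₁) :=
      integral_nonneg fun _ => sq_nonneg _
    have h2 : 0 ≤ ∫ y, secondComponent P₀ ktil y ^ 2 ∂(Q₀ : Measure Ω₂) :=
      integral_nonneg fun _ => sq_nonneg _
    -- Additivity gives `∫ k̃² = ∫ k̃₁² + ∫ k̃₂²`, so the two component norms cannot both vanish.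
    have hsum := integral_mul_eq_of_ae_eq_components hf2 hf2 hadd
    simp only [← sq] at hsum
    have hne : (∫ x, firstComponent Q₀ ktil x ^ 2 ∂(P₀ : Measure Ω₁)) +
        ∫ y, secondComponent P₀ ktil y ^ 2 ∂(Q₀ : Measure Ω₂) ≠ 0 := hsum ▸ hktil_ne
    have hd0 := hd.1
    rcases h1.lt_or_eq with h | h
    · exact add_pos_of_pos_of_nonneg (mul_pos (by positivity) h) (mul_nonneg (by positivity) h2)
    · have : 0 < ∫ y, secondComponent P₀ ktil y ^ 2 ∂(Q₀ : Measure Ω₂) :=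
        lt_of_le_of_ne h2 fun h' => hne (by rw [← h, ← h', add_zero])
      exact add_pos_of_nonneg_of_pos (mul_nonneg (by positivity) h1) (mul_pos (by positivity) this)
  have hscore : ∀ {P : ℝ → ProbabilityMeasure Ω₁} {Q : ℝ → ProbabilityMeasure Ω₂}
      {g : Ω₁ × Ω₂ → ℝ}, P 0 = P₀ → Q 0 = Q₀ →
      IsL2DiffCurve (prodFamily Pfam Qfam) (fun t => (P t).prod (Q t)) g →
      HasScore (fun t => (P t : Measure Ω₁).prod (Q t : Measure Ω₂))
        ((P₀ : Measure Ω₁).prod (Q₀ : Measure Ω₂)) g := by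
    intro P Q g hP hQ hc
    rw [← hP, ← hQ]
    exact hc.hasScore
  have hlocal : ∀ {P : ℝ → ProbabilityMeasure Ω₁} {Q : ℝ → ProbabilityMeasure Ω₂}
      {g : Ω₁ × Ω₂ → ℝ}, P 0 = P₀ → Q 0 = Q₀ →
      IsL2DiffCurve (prodFamily Pfam Qfam) (fun t => (P t).prod (Q t)) g →
      ∀ {t : ℕ → ℝ} {τ : ℝ}, Tendsto t atTop (𝓝[>] 0) →
      Tendsto (fun n : ℕ => t n * √n) atTop (𝓝 τ) →
      Tendsto (fun n => localValue k P Q n (t n)) atTop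
        (𝓝 (τ * ∫ z, ktil z * g z ∂((P₀ : Measure Ω₁).prod (Q₀ : Measure Ω₂)))) := by
    intro P Q g hP hQ hc t τ ht hτ
    rw [← hP, ← hQ] at hgrad ⊢
    exact tendsto_localValue hgrad hc ht hτ
  have hne : 𝓝[>] (0 : ℝ) ≤ 𝓝[≠] 0 := nhdsWithin_mono _ fun x hx => ne_of_gt hx
  refine ⟨fun n => ?_, fun n x => ?_, ?_, ?_⟩
  · rw [oneSidedTest_eq_indicator]
    exact measurable_one.indicator
      (measurable_twoSampleTestStat hgrad.measurable _ _ measurableSet_Ioi)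
  · unfold oneSidedTest
    split_ifs <;> simp
  · rintro μ ⟨s, hs, rfl⟩
    have hs0 := hs.tendsto_nhdsGT
    obtain ⟨θ, hθ, hlim⟩ := hnonpos s hs
    obtain ⟨-, τ, -, hτ⟩ := hs
    -- Uniqueness of limits identifies the assumed limit `θ` with the mean of the limiting normal
    -- law; its sign then settles the bound.
    have heq := tendsto_nhds_unique hlim (hlocal hP' hQ' hcurve' hs0 hτ)
    rw [(tendsto_integral_oneSidedTest (hscore hP' hQ' hcurve') hgrad.measurable hf2 hf0 hadd hn hd
      hnd α hv (hs0.mono_right hne) hτ).limsup_eq, ← heq]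
    exact gaussianReal_real_Ioi_quantile_le hv hα hθ
  · rintro μ ⟨t, ht, rfl⟩
    have ht0 := ht.tendsto_nhdsGT
    obtain ⟨θ, hθ, hlim⟩ := hpos t ht
    obtain ⟨-, τ, -, hτ⟩ := ht
    have heq := tendsto_nhds_unique hlim (hlocal hP hQ hcurve ht0 hτ)
    rw [(tendsto_integral_oneSidedTest (hscore hP hQ hcurve) hgrad.measurable hf2 hf0 hadd hn hd
      hnd α hv (ht0.mono_right hne) hτ).liminf_eq, ← heq]
    exact le_gaussianReal_real_Ioi_quantile hv hα hθ.le
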